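/- Let $n\ge 1$ and let $F:\mathbb{R}^{n+1}\to[0,\infty)$ be a Minkowski norm: $F$ is convex, $F(tx)=tF(x)$ for $t>0$, $F(x)>0$ for $x\ne 0$, $F$ is $C^\infty$ on $\mathbb{R}^{n+1}\setminus\{0\}$, and the Hessian of $\frac12F^2$ is positive definite on $\mathbb{R}^{n+1}\setminus\{0\}$. Let $\mathcal{W}=\{x\in\mathbb{R}^{n+1}: F(x)=1\}$, and for $x\neq 0$ put $$G(x)(\xi,\eta)=\sum_{\alpha,\beta}\frac{\partial^2(\frac12F^2)}{\partial x^\alpha\partial x^\beta}(x)\,\xi^\alpha\eta^\beta,\qquad Q(x)(\xi,\eta,\zeta)=\sum_{\alpha,\beta,\gamma}\frac{\partial^3(\frac12F^2)}{\partial x^\alpha\partial x^\beta\partial x^\gamma}(x)\,\xi^\alpha\eta^\beta\zeta^\gamma .$$ Equip $\mathcal{W}$ with the Riemannian metric $g(z)=G(z)|_{T_z\mathcal{W}}$. For $w\in C^2(\mathcal{W})$, let $w_i$, $w_{ij}$ be the components of the first and second covariant derivatives of $w$ (Levi-Civita connection of $g$) and $Q_{ijk}$ those of $Q|_{T\mathcal{W}}$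 in a local $g$-orthonormal frame, and set $$u_{ij}[w]=w_{ij}-\tfrac12\sum_k Q_{ijk}w_k+w\,\delta_{ij}.$$ Let $S\in C^2(\mathcal{W})$ be admissible, i.e. the matrix $(u_{ij}[S])$ is positive definite at every point of $\mathcal{W}$, and let $L_S$ be the linearization of $S\mapsto\sigma_n(u_{ij}[S])=\det(u_{ij}[S])$: $$L_S(v)=\sum_{i,j=1}^n\frac{\partial\sigma_n}{\partial u_{ij}}\big(u[S]\big)\,u_{ij}[v].$$ If $v\in C^2(\mathcal{W})$ satisfies $L_S(v)=0$ on $\mathcal{W}$, then there are constants $a_1,\dots,a_{n+1}\in\mathbb{R}$ such that $$v(z)=\sum_{\alpha=1}^{n+1}a_\alpha\,G(z)(z,E^\alpha)\qquad\text{for all } z\in\mathcal{W},$$ where $E^1,\dots,E^{n+1}$ is the standard basis of $\mathbb{R}^{n+1}$. -/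

import Mathlib

open scoped ContDiff

noncomputable section

namespace AnisoMinkowski

/-- The ambient space `ℝ^{n+1}`. -/
abbrev Amb (n : ℕ) := EuclideanSpace ℝ (Fin (n + 1))

/-- The space `ℝ^n` in which local coordinates take their values. -/
abbrev Par (n : ℕ) := EuclideanSpace ℝ (Fin n)

/-- The function `½ F²`. -/
def halfSq {n : ℕ} (F : Amb n → ℝ) : Amb n → ℝ := fun x => (1 / 2) * F x ^ 2

/-- `G(x)(ξ, η) = ∑ ∂²(½F²)/∂x^α∂x^β (x) ξ^α η^β`. -/
def G {n : ℕ} (F : Amb n → ℝ) (x ξ η : Amb n) : ℝ :=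
  fderiv ℝ (fderiv ℝ (halfSq F)) x ξ η

/-- `Q(x)(ξ, η, ζ) = ∑ ∂³(½F²)/∂x^α∂x^β∂x^γ (x) ξ^α η^β ζ^γ`. -/
def Q {n : ℕ} (F : Amb n → ℝ) (x ξ η ζ : Amb n) : ℝ :=
  fderiv ℝ (fderiv ℝ (fderiv ℝ (halfSq F))) x ξ η ζ

/-- Minkowski norms on `ℝ^{n+1}`: convex, positively `1`-homogeneous, positive and smooth away
from the origin, with `Hess (½F²)` positive definite away from the origin.
Symmetry `F (-x) = F x` is not required. -/
structure IsMinkowskiNorm {n : ℕ} (F : Amb n → ℝ) : Prop where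
  convex : ConvexOn ℝ Set.univ F
  homogeneous : ∀ t : ℝ, 0 < t → ∀ x, F (t • x) = t * F x
  pos : ∀ x, x ≠ 0 → 0 < F x
  smooth : ContDiffOn ℝ ∞ F {0}ᶜ
  elliptic : ∀ x, x ≠ 0 → ∀ ξ, ξ ≠ 0 → 0 < G F x ξ ξ

/-- The Wulff shape `{F = 1}`. -/
def wulff {n : ℕ} (F : Amb n → ℝ) : Set (Amb n) := {x | F x = 1}

/-- `X : U → 𝒲` is a smooth local parametrization of the Wulff shape: `U ⊆ ℝ^n` is open and `X` is
a smooth injective immersion of `U` into the Wulff shape (its inverse is a local coordinate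
system). -/
structure IsLocalParam {n : ℕ} (F : Amb n → ℝ) (U : Set (Par n)) (X : Par n → Amb n) :
    Prop where
  isOpen : IsOpen U
  smooth : ContDiffOn ℝ ∞ X U
  mapsTo : Set.MapsTo X U (wulff F)
  injOn : Set.InjOn X U
  immersion : ∀ y ∈ U, Function.Injective (fderiv ℝ X y)

/-- The coordinate derivative `∂_i f`. -/
def pd {n : ℕ} {V : Type*} [NormedAddCommGroup V] [NormedSpace ℝ V]
    (i : Fin n) (f : Par n → V) (y : Par n) : V :=
  fderiv ℝ f y (EuclideanSpace.single i 1)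

/-- The matrix `g_ij = G(X)(∂_i X, ∂_j X)` of the Riemannian metric `g = G|_𝒲` in the local
coordinates given by `X`. -/
def metric {n : ℕ} (F : Amb n → ℝ) (X : Par n → Amb n) (y : Par n) :
    Matrix (Fin n) (Fin n) ℝ :=
  Matrix.of fun i j => G F (X y) (pd i X y) (pd j X y)

/-- The Christoffel symbol `Γ^k_ij = ½ g^{kl} (∂_i g_jl + ∂_j g_il - ∂_l g_ij)` of the Levi-Civita
connection of `g`. -/
def christoffel {n : ℕ} (F : Amb n → ℝ) (X : Par n → Amb n) (k i j : Fin n) (y : Par n) : ℝ :=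
  (1 / 2) * ∑ l, (metric F X y)⁻¹ k l *
    (pd i (fun y' => metric F X y' j l) y + pd j (fun y' => metric F X y' i l) y
      - pd l (fun y' => metric F X y' i j) y)

/-- The second covariant derivative `v_ij = ∂_i ∂_j v - Γ^k_ij ∂_k v` of a function `v` on the
Wulff shape, with respect to `g`. -/
def covHess {n : ℕ} (F : Amb n → ℝ) (X : Par n → Amb n) (v : Amb n → ℝ) (i j : Fin n)
    (y : Par n) : ℝ :=
  pd i (pd j (v ∘ X)) y - ∑ k, christoffel F X k i j y * pd k (v ∘ X) y

/-- The covariant components `v_ij - ½ Q_ijk v^k + v g_ij`, `v^k = g^{kl} ∂_l v`, of the tensor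
which reads `v_ij - ½ Q_ijk v_k + v δ_ij` in a `g`-orthonormal frame. -/
def uTensor {n : ℕ} (F : Amb n → ℝ) (X : Par n → Amb n) (v : Amb n → ℝ) (y : Par n) :
    Matrix (Fin n) (Fin n) ℝ :=
  Matrix.of fun i j =>
    covHess F X v i j y
      - (1 / 2) * ∑ k, Q F (X y) (pd i X y) (pd j X y) (pd k X y) *
          (∑ l, (metric F X y)⁻¹ k l * pd l (v ∘ X) y)
      + v (X y) * metric F X y i j

/-- The mixed components `g^{ik} u_kj` of `uTensor`. In a `g`-orthonormal frame they are the `u_ij`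
themselves, and a change of frame conjugates this matrix, so that its determinant, and the
linearization of the latter, may be computed in any frame. -/
def uMixed {n : ℕ} (F : Amb n → ℝ) (X : Par n → Amb n) (v : Amb n → ℝ) (y : Par n) :
    Matrix (Fin n) (Fin n) ℝ :=
  (metric F X y)⁻¹ * uTensor F X v y

/-- The partial derivative `∂σ_n/∂u_ij` of `σ_n = det` with respect to the entry `u_ij`. -/
def dSigma {n : ℕ} (u : Matrix (Fin n) (Fin n) ℝ) (i j : Fin n) : ℝ :=
  deriv (fun t : ℝ => (u + Matrix.single i j t).det) 0

/-- `L_S(v) = ∑ ∂σ_n/∂u_ij(u[S]) u[v]_ij`, the linearization at `S` of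
`S ↦ det (S_ij - ½ Q_ijk S_k + S δ_ij)`, at the point `X y` of the Wulff shape. -/
def linOp {n : ℕ} (F : Amb n → ℝ) (X : Par n → Amb n) (S v : Amb n → ℝ) (y : Par n) : ℝ :=
  ∑ i, ∑ j, dSigma (uMixed F X S y) i j * uMixed F X v y i j

/-- `S ∈ C²(𝒲)` is admissible: `S_ij - ½ Q_ijk S_k + S δ_ij` is positive definite at every point
of the Wulff shape. -/
structure IsAdmissible {n : ℕ} (F S : Amb n → ℝ) : Prop where
  contDiffOn : ContDiffOn ℝ 2 S (wulff F)
  posDef : ∀ (U : Set (Par n)) (X : Par n → Amb n), IsLocalParam F U X →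
    ∀ y ∈ U, (uTensor F X S y).PosDef

/-- `v` lies in the kernel of `L_S`: `L_S(v) = 0` at every point of the Wulff shape. -/
def InKernel {n : ℕ} (F S v : Amb n → ℝ) : Prop :=
  ∀ (U : Set (Par n)) (X : Par n → Amb n), IsLocalParam F U X → ∀ y ∈ U, linOp F X S v y = 0

end AnisoMinkowski

end

open scoped ContDiff

noncomputable section

/-! ### The Jacobian determinant is a null Lagrangian -/

section

namespace AnisoMinkowski

open MeasureTheory Filter Topology

/-! The Legendre transformation `x ↦ ∇(½F²)(x)` is a diffeomorphism of the punctured space, and it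
carries functions on the Wulff shape to positively 1-homogeneous functions `h`, `f` (the extensions
of `S`, `v`) on the dual space. Under it the tensor `w_ij - ½ Q_ijk w_k + w g_ij` becomes the
ordinary Euclidean Hessian of the extension (`uTensor_eq`); the Christoffel symbols and the `Q` term
are what the change of variables produces. By homogeneity these Hessians annihilate the radial
direction, so only their restrictions `A`, `B` to `x^⊥` matter. Admissibility says that `A` is
positive definite, and `L_S(v) = 0` says that `tr (A⁻¹ B) = 0`. The functions `G(z)(z, E^α)` are the
linear coordinates of the Legendre image, so it has to be shown that `f` is linear.

This is infinitesimal rigidity (`exists_eq_linear`). Subtracting a linear function, which does not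
change the Hessian, makes `h` positive. With radial cutoffs `l`, `m` supported away from the origin,
let `J_t` be the Jacobian determinant of `l ∇h + t m ∇f`. Its integral is zero for every `t`,
because the field has compact support. Pointwise it factors as a radial term, affine in `t` and
positive on the support of `m` for small `t`, times `det (l A + t m B)`. Since `tr (A⁻¹ B) = 0`, the
AM-GM inequality bounds the latter by `det (l A)`, with equality only if `t m B = 0`.

Hence `J_t + J_{-t} - 2 J_0` is nonpositive with integral zero, so it vanishes identically and `B =
0` wherever `m ≠ 0`. As the centre of the cutoff is arbitrary, `Hess f = 0`; the punctured space is
connected because `n ≥ 1`, so `∇f` is constant, and Euler's identity makes `f` linear. -/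

theorem det_smul_add {ι : Type*} [Fintype ι] [DecidableEq ι] (A B : Matrix ι ι ℝ) (t : ℝ) :
    (t • A + B).det = ∑ s : Finset ι, t ^ s.card * (Matrix.of (s.piecewise A B)).det := by
  have h1 : (t • A + B).det = ∑ s : Finset ι, (Matrix.of (s.piecewise (t • A) B)).det :=
    (Matrix.detRowAlternating (n := ι) (R := ℝ)).map_add_univ (t • A) B
  refine h1.trans (Finset.sum_congr rfl fun s _ => ?_)
  have h2 : (Matrix.of (s.piecewise (fun i => t • s.piecewise A B i) (s.piecewise A B))).det =
      (∏ _i ∈ s, t) * (Matrix.of (s.piecewise A B)).det :=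
    (Matrix.detRowAlternating (n := ι) (R := ℝ)).toMultilinearMap.map_piecewise_smul
      (fun _ => t) (s.piecewise A B) s
  have h3 : s.piecewise (fun i => t • s.piecewise A B i) (s.piecewise A B) =
      s.piecewise (t • A) B := by
    ext i j
    by_cases hi : i ∈ s <;> simp [Finset.piecewise, hi]
  rwa [h3, Finset.prod_const] at h2

/-- The determinant of `1 + t A` is a polynomial in `t` with coefficients continuous in `A`, and
with leading coefficient `det A`. -/
theorem exists_det_one_add_smul_eq_sum (n : ℕ) :
    ∃ c : Finset (Fin (n + 1)) → (Amb n →L[ℝ] Amb n) → ℝ, (∀ s, Continuous (c s)) ∧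
      (∀ A, c Finset.univ A = A.det) ∧
      ∀ (t : ℝ) (A : Amb n →L[ℝ] Amb n),
        (ContinuousLinearMap.id ℝ (Amb n) + t • A).det = ∑ s, t ^ s.card * c s A := by
  classical
  let b := (EuclideanSpace.basisFun (Fin (n + 1)) ℝ).toBasis
  let M : (Amb n →L[ℝ] Amb n) →ₗ[ℝ] Matrix (Fin (n + 1)) (Fin (n + 1)) ℝ :=
    (LinearMap.toMatrix b b).toLinearMap ∘ₗ ContinuousLinearMap.coeLM ℝ
  have hM : Continuous M := LinearMap.continuous_of_finiteDimensional M
  have hdet (A : Amb n →L[ℝ] Amb n) : A.det = (M A).det := by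
    rw [ContinuousLinearMap.det, ← LinearMap.det_toMatrix b]; rfl
  refine ⟨fun s A => (Matrix.of (s.piecewise (M A) (1 : Matrix _ _ ℝ))).det, fun s => ?_,
    fun A => ?_, fun t A => ?_⟩
  · refine Continuous.matrix_det (continuous_matrix fun i j => ?_)
    by_cases hi : i ∈ s
    · simpa [Finset.piecewise, hi] using hM.matrix_elem i j
    · simpa [Finset.piecewise, hi] using continuous_const
  · rw [hdet]
    refine congrArg Matrix.det ?_
    ext i j
    simp [Finset.piecewise]
  · have h1 : M (ContinuousLinearMap.id ℝ (Amb n) + t • A) = t • M A + 1 := by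
      refine (map_add M _ _).trans ((add_comm _ _).trans (congrArg₂ _ (map_smul M t A) ?_))
      exact LinearMap.toMatrix_id b
    rw [hdet, h1]
    exact det_smul_add (M A) 1 t

/-- For small `t` the map `x ↦ x + t φ(x)` is a small Lipschitz perturbation of the identity, hence
bijective, and it fixes every point outside the ball. So it maps the ball onto itself, and the
change of variables formula applies, the Jacobian being positive by compactness. -/
theorem eventually_integral_det_one_add_smul {n : ℕ} {φ : Amb n → Amb n} (hφ : ContDiff ℝ 1 φ)
    (hc : HasCompactSupport φ) {R : ℝ} (hR : tsupport φ ⊆ Metric.closedBall 0 R) :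
    ∀ᶠ t : ℝ in 𝓝 0, ∫ x in Metric.closedBall (0 : Amb n) R,
      (ContinuousLinearMap.id ℝ (Amb n) + t • fderiv ℝ φ x).det =
        volume.real (Metric.closedBall (0 : Amb n) R) := by
  obtain ⟨K, hK⟩ := hφ.lipschitzWith_of_hasCompactSupport hc one_ne_zero
  have hpos : ∀ᶠ t : ℝ in 𝓝 0, ∀ x ∈ Metric.closedBall (0 : Amb n) R,
      0 < (ContinuousLinearMap.id ℝ (Amb n) + t • fderiv ℝ φ x).det := by
    refine (isCompact_closedBall _ _).eventually_forall_of_forall_eventually fun x _ => ?_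
    have : Continuous fun z : ℝ × Amb n =>
        (ContinuousLinearMap.id ℝ (Amb n) + z.1 • fderiv ℝ φ z.2).det :=
      ContinuousLinearMap.continuous_det.comp (continuous_const.add
        (continuous_fst.smul ((hφ.continuous_fderiv one_ne_zero).comp continuous_snd)))
    refine this.continuousAt.eventually (lt_mem_nhds ?_)
    simp [ContinuousLinearMap.det]
  have hsmall : ∀ᶠ t : ℝ in 𝓝 0, ‖t‖₊ * K < 1 := by
    have : Continuous fun t : ℝ => ‖t‖₊ * K := by fun_prop
    exact this.continuousAt.eventually (gt_mem_nhds (by simp))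
  filter_upwards [hpos, hsmall] with t ht hts
  set g : Amb n → Amb n := fun x => x + t • φ x with hg
  have happ : ApproximatesLinearOn g
      ((ContinuousLinearEquiv.refl ℝ (Amb n) : Amb n ≃L[ℝ] Amb n) : Amb n →L[ℝ] Amb n)
      Set.univ (‖t‖₊ * K) := by
    intro x _ y _
    have h1 : g x - g y - ((ContinuousLinearEquiv.refl ℝ (Amb n) : Amb n ≃L[ℝ] Amb n) :
        Amb n →L[ℝ] Amb n) (x - y) = t • (φ x - φ y) := by
      simp only [hg, ContinuousLinearEquiv.coe_refl, ContinuousLinearMap.id_apply, smul_sub]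
      abel
    rw [h1, norm_smul, NNReal.coe_mul, coe_nnnorm, mul_assoc]
    exact mul_le_mul_of_nonneg_left (hK.norm_sub_le x y) (norm_nonneg _)
  have hlt : ‖t‖₊ * K < ‖(((ContinuousLinearEquiv.refl ℝ (Amb n)).symm : Amb n ≃L[ℝ] Amb n) :
      Amb n →L[ℝ] Amb n)‖₊⁻¹ := by
    have : ‖(((ContinuousLinearEquiv.refl ℝ (Amb n)).symm : Amb n ≃L[ℝ] Amb n) :
      Amb n →L[ℝ] Amb n)‖₊ = 1 := by
      ext; exact ContinuousLinearMap.norm_id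
    rw [this, inv_one]; exact hts
  have hinj : Function.Injective g := by
    rw [← Set.injOn_univ]; exact happ.injOn (Or.inr hlt)
  have hsurj : Function.Surjective g := happ.surjective (Or.inr hlt)
  have hout : ∀ x ∉ Metric.closedBall (0 : Amb n) R, g x = x := by
    intro x hx
    have : φ x = 0 := image_eq_zero_of_notMem_tsupport fun h => hx (hR h)
    simp [hg, this]
  have himg : g '' Metric.closedBall (0 : Amb n) R = Metric.closedBall (0 : Amb n) R := by
    apply Set.Subset.antisymm
    · rintro _ ⟨x, hx, rfl⟩
      by_contra hgx
      have := hinj (hout _ hgx)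
      rw [this] at hgx
      exact hgx hx
    · intro y hy
      obtain ⟨x, rfl⟩ := hsurj y
      refine ⟨x, ?_, rfl⟩
      by_contra hx
      rw [hout x hx] at hy
      exact hx hy
  have hder : ∀ x ∈ Metric.closedBall (0 : Amb n) R,
      HasFDerivWithinAt g (ContinuousLinearMap.id ℝ (Amb n) + t • fderiv ℝ φ x)
        (Metric.closedBall 0 R) x := fun x _ =>
    ((hasFDerivAt_id x).add ((hφ.differentiable one_ne_zero x).hasFDerivAt.const_smul
      t)).hasFDerivWithinAt
  have key := integral_image_eq_integral_abs_det_fderiv_smul volume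
    (Metric.isClosed_closedBall.measurableSet) hder hinj.injOn (fun _ => (1 : ℝ))
  rw [himg] at key
  simp only [integral_const, smul_eq_mul, mul_one, MeasurableSet.univ, measureReal_restrict_apply,
    Set.univ_inter] at key
  rw [key]
  exact setIntegral_congr_fun Metric.isClosed_closedBall.measurableSet
    fun x hx => (abs_of_pos (ht x hx)).symm

/-- The Jacobian determinant is a null Lagrangian. -/
theorem integral_det_fderiv_eq_zero {n : ℕ} {φ : Amb n → Amb n} (hφ : ContDiff ℝ 1 φ)
    (hc : HasCompactSupport φ) : ∫ x, (fderiv ℝ φ x).det = 0 := by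
  classical
  obtain ⟨c, hcont, huniv, hdet⟩ := exists_det_one_add_smul_eq_sum n
  obtain ⟨R, hR⟩ := hc.isCompact.isBounded.subset_closedBall (0 : Amb n)
  have hev := eventually_integral_det_one_add_smul hφ hc hR
  set B := Metric.closedBall (0 : Amb n) R
  have hint (s) : IntegrableOn (fun x => c s (fderiv ℝ φ x)) B :=
    ((hcont s).comp (hφ.continuous_fderiv one_ne_zero)).continuousOn.integrableOn_compact
      (isCompact_closedBall _ _)
  -- The integral minus the volume is a polynomial in `t` that vanishes near 0, hence is zero. Its
  -- coefficient of `t ^ (n + 1)`, to which the volume does not contribute, is the integral sought.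
  set p : Polynomial ℝ := (∑ s : Finset (Fin (n + 1)),
    Polynomial.C (∫ x in B, c s (fderiv ℝ φ x)) * Polynomial.X ^ s.card) -
      Polynomial.C (volume.real B) with hp
  have heval (t : ℝ) : p.eval t = (∫ x in B, (ContinuousLinearMap.id ℝ (Amb n) +
      t • fderiv ℝ φ x).det) - volume.real B := by
    simp only [hdet, hp, Polynomial.eval_sub, Polynomial.eval_finsetSum, Polynomial.eval_mul,
      Polynomial.eval_C, Polynomial.eval_pow, Polynomial.eval_X]
    rw [integral_finsetSum _ fun s _ => (hint s).const_mul _]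
    congr 1
    refine Finset.sum_congr rfl fun s _ => ?_
    rw [integral_const_mul, mul_comm]
  have hp0 : p = 0 := by
    refine Polynomial.eq_zero_of_infinite_isRoot p (Set.Infinite.mono ?_
      (infinite_of_mem_nhds (0 : ℝ) hev))
    intro t ht
    simp only [Set.mem_ofPred_eq, Polynomial.IsRoot.def] at ht ⊢
    rw [heval, ht, sub_self]
  have hcoef : p.coeff (n + 1) = ∫ x in B, (fderiv ℝ φ x).det := by
    simp only [hp, Polynomial.coeff_sub, Polynomial.finsetSum_coeff, Polynomial.coeff_C_mul,
      Polynomial.coeff_X_pow, Polynomial.coeff_C, Nat.succ_ne_zero, if_false, sub_zero]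
    rw [Finset.sum_eq_single Finset.univ]
    · simp [huniv]
    · intro s _ hs
      have : n + 1 ≠ s.card := by
        intro h
        exact hs (Finset.card_eq_iff_eq_univ s |>.1 (by simp [← h]))
      simp [this]
    · simp
  rw [hp0, Polynomial.coeff_zero] at hcoef
  rw [hcoef]
  refine (setIntegral_eq_integral_of_forall_compl_eq_zero fun x hx => ?_).symm
  have : fderiv ℝ φ x = 0 := by
    refine image_eq_zero_of_notMem_tsupport fun h => hx (hR (tsupport_fderiv_subset ℝ h))
  rw [this, ContinuousLinearMap.det, ContinuousLinearMap.toLinearMap_zero]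
  exact LinearMap.det_zero''

end AnisoMinkowski

end

/-! ### A determinant inequality with its equality case -/

section

namespace AnisoMinkowski

/-- AM-GM through `z ≤ exp (z - 1)`, strict unless `z = 1`: the product of the right-hand sides is
1. -/
theorem prod_le_one_of_sum_eq_card {ι : Type*} [Fintype ι] {z : ι → ℝ} (hz : ∀ i, 0 < z i)
    (hsum : ∑ i, z i = Fintype.card ι) : ∏ i, z i ≤ 1 ∧ (∏ i, z i = 1 → ∀ i, z i = 1) := by
  have h0 : ∏ i, Real.exp (z i - 1) = 1 := by
    rw [← Real.exp_sum, Finset.sum_sub_distrib, hsum]; simp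
  have hle (i) : z i ≤ Real.exp (z i - 1) := by
    have := Real.add_one_le_exp (z i - 1); linarith
  refine ⟨h0 ▸ Finset.prod_le_prod (fun i _ => (hz i).le) fun i _ => hle i, fun h1 i => ?_⟩
  by_contra hi
  have hlt : z i < Real.exp (z i - 1) := by
    have := Real.add_one_lt_exp (x := z i - 1) (sub_ne_zero.2 hi); linarith
  have := Finset.prod_lt_prod (fun i _ => hz i) (fun i _ => hle i) ⟨i, Finset.mem_univ i, hlt⟩
  rw [h0, h1] at this
  exact lt_irrefl _ this

open Matrix in
open scoped MatrixOrder in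
/-- The determinant is maximal at `A` among the positive definite matrices `A + B` with
`tr (A⁻¹ B) = 0`. -/
theorem det_add_le_det {ι : Type*} [Fintype ι] [DecidableEq ι] {A B : Matrix ι ι ℝ}
    (hA : A.PosDef) (hAB : (A + B).PosDef) (htr : (A⁻¹ * B).trace = 0) :
    (A + B).det ≤ A.det ∧ ((A + B).det = A.det → B = 0) := by
  -- With `A = P* P`, the matrix `N = P⁻* (A + B) P⁻¹` is positive definite of trace `card ι`, so
  -- AM-GM applies to its eigenvalues; equality forces `N = 1`.
  obtain ⟨P, hP⟩ := CStarAlgebra.nonneg_iff_eq_star_mul_self.mp hA.posSemidef.nonneg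
  have hdet : A.det = P.det * P.det := by
    rw [hP, det_mul, star_eq_conjTranspose, det_conjTranspose, star_trivial]
  have hPu : IsUnit P.det := by
    refine isUnit_iff_ne_zero.2 fun h => hA.det_pos.ne' ?_
    rw [hdet, h, mul_zero]
  have hPP : P * P⁻¹ = 1 := mul_nonsing_inv P hPu
  have hPP' : star P⁻¹ * star P = 1 := by rw [← star_mul, hPP, star_one]
  have hPP'' : star P * star P⁻¹ = 1 := by rw [← star_mul, nonsing_inv_mul P hPu, star_one]
  have hN := hAB.conjTranspose_mul_mul_same (B := P⁻¹)
    (mulVec_injective_of_isUnit ((isUnit_iff_isUnit_det _).2 (isUnit_nonsing_inv_det P hPu)))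
  rw [← star_eq_conjTranspose] at hN
  set N := star P⁻¹ * (A + B) * P⁻¹ with hNdef
  have hAB' : A + B = star P * N * P := by
    simp only [hNdef, ← Matrix.mul_assoc]
    rw [hPP'', Matrix.one_mul, Matrix.mul_assoc, nonsing_inv_mul P hPu, Matrix.mul_one]
  have hdetN : (A + B).det = A.det * N.det := by
    rw [hAB', hdet, det_mul, det_mul, star_eq_conjTranspose, det_conjTranspose, star_trivial]
    ring
  have hAinv : A⁻¹ = P⁻¹ * star P⁻¹ := by
    refine inv_eq_left_inv ?_
    rw [hP, Matrix.mul_assoc, ← Matrix.mul_assoc (star P⁻¹), hPP', Matrix.one_mul,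
      nonsing_inv_mul P hPu]
  have htrN : N.trace = Fintype.card ι := by
    rw [hNdef, trace_mul_comm, ← Matrix.mul_assoc, ← hAinv, Matrix.mul_add, trace_add, htr,
      nonsing_inv_mul A (isUnit_iff_ne_zero.2 hA.det_pos.ne'), trace_one, add_zero]
  have hprod := prod_le_one_of_sum_eq_card hN.eigenvalues_pos
    (by simpa using hN.isHermitian.trace_eq_sum_eigenvalues.symm.trans htrN)
  have hdetN' : N.det = ∏ i, hN.isHermitian.eigenvalues i := by
    simpa using hN.isHermitian.det_eq_prod_eigenvalues
  rw [← hdetN'] at hprod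
  refine ⟨by rw [hdetN]; exact mul_le_of_le_one_right hA.det_pos.le hprod.1, fun h => ?_⟩
  rw [hdetN] at h
  have h1 := hprod.2 (mul_left_cancel₀ hA.det_pos.ne' (h.trans (mul_one _).symm))
  have hN1 : N = 1 := by
    have h2 : hN.isHermitian.eigenvalues = 1 := funext h1
    have h3 := hN.isHermitian.spectral_theorem
    have h4 : Matrix.diagonal (RCLike.ofReal ∘ hN.isHermitian.eigenvalues) =
        (1 : Matrix ι ι ℝ) := by
      rw [h2, ← Matrix.diagonal_one]; congr 1
    rw [h4, map_one] at h3
    exact h3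
  rw [hN1, Matrix.mul_one, ← hP] at hAB'
  exact left_eq_add.1 hAB'.symm

end AnisoMinkowski

end

/-! ### Positively 1-homogeneous functions and their supporting hyperplanes -/

section

namespace AnisoMinkowski

open Filter Topology

/-- Positively `1`-homogeneous functions which are `C²` away from the origin. -/
structure IsConic {n : ℕ} (h : Amb n → ℝ) : Prop where
  smooth : ContDiffOn ℝ 2 h {0}ᶜ
  homogeneous : ∀ t : ℝ, 0 < t → ∀ x, x ≠ 0 → h (t • x) = t * h x

/-- The Hessian as an iterated Fréchet derivative. -/
abbrev hess {n : ℕ} (h : Amb n → ℝ) (x : Amb n) : Amb n →L[ℝ] Amb n →L[ℝ] ℝ :=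
  fderiv ℝ (fderiv ℝ h) x

theorem eventually_ne_zero {n : ℕ} {x : Amb n} (hx : x ≠ 0) : ∀ᶠ y in 𝓝 x, y ≠ 0 :=
  isOpen_compl_singleton.mem_nhds hx

/-- The factor `c` is kept apart from `t` so that one statement serves degree 1 (`c = t`), degree 0
(`c = 1`) and degree 2 (`c = t ^ 2`). -/
theorem fderiv_smul_of_homogeneous {n : ℕ} {V : Type*} [NormedAddCommGroup V] [NormedSpace ℝ V]
    {f : Amb n → V} {t c : ℝ} (ht : 0 < t) (hf : ∀ x, x ≠ 0 → f (t • x) = c • f x)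
    {x : Amb n} (hx : x ≠ 0) (hd : ∀ x, x ≠ 0 → DifferentiableAt ℝ f x) :
    fderiv ℝ f (t • x) = (t⁻¹ * c) • fderiv ℝ f x := by
  have h1 : HasFDerivAt (fun y => f (t • y))
      ((fderiv ℝ f (t • x)).comp (t • ContinuousLinearMap.id ℝ (Amb n))) x :=
    (hd _ (smul_ne_zero ht.ne' hx)).hasFDerivAt.comp x ((hasFDerivAt_id x).const_smul t)
  have h2 : HasFDerivAt (fun y => f (t • y)) (c • fderiv ℝ f x) x := by
    refine ((hd x hx).hasFDerivAt.const_smul c).congr_of_eventuallyEq ?_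
    filter_upwards [eventually_ne_zero hx] with y hy using hf y hy
  have h3 := h1.unique h2
  ext ξ
  have h4 := congrArg (fun L => L (t⁻¹ • ξ)) h3
  simpa [smul_smul, ht.ne', mul_comm] using h4

/-- Euler's identity. -/
theorem fderiv_self_of_homogeneous {n : ℕ} {V : Type*} [NormedAddCommGroup V] [NormedSpace ℝ V]
    {f : Amb n → V} (d : ℕ) {x : Amb n} (hf : ∀ t : ℝ, 0 < t → f (t • x) = t ^ d • f x)
    (hd : DifferentiableAt ℝ f x) :
    fderiv ℝ f x x = (d : ℝ) • f x := by
  have h1 : HasDerivAt (fun t : ℝ => f (t • x)) (fderiv ℝ f x x) 1 := by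
    have h0 : HasDerivAt (fun t : ℝ => t • x) x 1 := by
      simpa using (hasDerivAt_id (1 : ℝ)).smul_const x
    have : HasFDerivAt f (fderiv ℝ f x) ((1 : ℝ) • x) := by
      rw [one_smul]; exact hd.hasFDerivAt
    exact this.comp_hasDerivAt 1 h0
  have h2 : HasDerivAt (fun t : ℝ => f (t • x)) ((d : ℝ) • f x) 1 := by
    have h0 : HasDerivAt (fun t : ℝ => t ^ d • f x) ((d : ℝ) • f x) 1 := by
      simpa using (hasDerivAt_pow d (1 : ℝ)).smul_const (f x)
    refine h0.congr_of_eventuallyEq ?_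
    filter_upwards [lt_mem_nhds (zero_lt_one' ℝ)] with t ht using hf t ht
  exact h1.unique h2

namespace IsConic

variable {n : ℕ} {h : Amb n → ℝ}

theorem contDiffAt (hh : IsConic h) {x : Amb n} (hx : x ≠ 0) : ContDiffAt ℝ 2 h x :=
  hh.smooth.contDiffAt (isOpen_compl_singleton.mem_nhds hx)

theorem differentiableAt (hh : IsConic h) {x : Amb n} (hx : x ≠ 0) : DifferentiableAt ℝ h x :=
  (hh.contDiffAt hx).differentiableAt two_ne_zero

theorem contDiffAt_fderiv (hh : IsConic h) {x : Amb n} (hx : x ≠ 0) :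
    ContDiffAt ℝ 1 (fderiv ℝ h) x :=
  (hh.contDiffAt hx).fderiv_right (by norm_num)

theorem differentiableAt_fderiv (hh : IsConic h) {x : Amb n} (hx : x ≠ 0) :
    DifferentiableAt ℝ (fderiv ℝ h) x :=
  (hh.contDiffAt_fderiv hx).differentiableAt one_ne_zero

theorem continuousAt_hess (hh : IsConic h) {x : Amb n} (hx : x ≠ 0) :
    ContinuousAt (hess h) x :=
  ((hh.contDiffAt_fderiv hx).fderiv_right (m := 0) (by norm_num)).continuousAt

theorem fderiv_smul (hh : IsConic h) {t : ℝ} (ht : 0 < t) {x : Amb n} (hx : x ≠ 0) :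
    fderiv ℝ h (t • x) = fderiv ℝ h x := by
  have := fderiv_smul_of_homogeneous (f := h) ht (c := t)
    (fun y hy => hh.homogeneous t ht y hy) hx fun y hy => hh.differentiableAt hy
  rwa [inv_mul_cancel₀ ht.ne', one_smul] at this

theorem hess_smul (hh : IsConic h) {t : ℝ} (ht : 0 < t) {x : Amb n} (hx : x ≠ 0) :
    hess h (t • x) = t⁻¹ • hess h x := by
  have := fderiv_smul_of_homogeneous (f := fderiv ℝ h) ht (c := 1)
    (fun y hy => by rw [hh.fderiv_smul ht hy, one_smul]) hx
    fun y hy => hh.differentiableAt_fderiv hy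
  rwa [mul_one] at this

theorem fderiv_self (hh : IsConic h) {x : Amb n} (hx : x ≠ 0) : fderiv ℝ h x x = h x := by
  simpa using fderiv_self_of_homogeneous 1
    (fun t ht => by simpa using hh.homogeneous t ht x hx) (hh.differentiableAt hx)

theorem hess_self (hh : IsConic h) {x : Amb n} (hx : x ≠ 0) : hess h x x = 0 := by
  simpa using fderiv_self_of_homogeneous (f := fderiv ℝ h) 0
    (fun t ht => by simpa using hh.fderiv_smul ht hx) (hh.differentiableAt_fderiv hx)

theorem hess_symm (hh : IsConic h) {x : Amb n} (hx : x ≠ 0) (ξ η : Amb n) :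
    hess h x ξ η = hess h x η ξ :=
  ((hh.contDiffAt hx).isSymmSndFDerivAt (by simp)) ξ η

theorem hess_apply_self (hh : IsConic h) {x : Amb n} (hx : x ≠ 0) (ξ : Amb n) :
    hess h x ξ x = 0 := by
  rw [hh.hess_symm hx, hh.hess_self hx]; rfl

theorem sub_linear (hh : IsConic h) (c : Amb n →L[ℝ] ℝ) : IsConic fun x => h x - c x where
  smooth := hh.smooth.sub c.contDiff.contDiffOn
  homogeneous t ht x hx := by simp [hh.homogeneous t ht x hx, mul_sub]

theorem fderiv_sub_linear (hh : IsConic h) (c : Amb n →L[ℝ] ℝ) {x : Amb n} (hx : x ≠ 0) :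
    fderiv ℝ (fun x => h x - c x) x = fderiv ℝ h x - c :=
  ((hh.differentiableAt hx).hasFDerivAt.sub c.hasFDerivAt).fderiv

theorem hess_sub_linear (hh : IsConic h) (c : Amb n →L[ℝ] ℝ) {x : Amb n} (hx : x ≠ 0) :
    hess (fun x => h x - c x) x = hess h x := by
  refine HasFDerivAt.fderiv ?_
  refine ((hh.differentiableAt_fderiv hx).hasFDerivAt.sub_const c).congr_of_eventuallyEq ?_
  filter_upwards [eventually_ne_zero hx] with y hy using hh.fderiv_sub_linear c hy

/-- A function whose Hessian is definite transversally to the radial direction lies strictly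
above its tangent hyperplanes. -/
theorem fderiv_lt_of_linearIndependent (hh : IsConic h)
    (hpos : ∀ x ξ : Amb n, LinearIndependent ℝ ![x, ξ] → 0 < hess h x ξ ξ)
    {x y : Amb n} (hxy : LinearIndependent ℝ ![x, y]) : fderiv ℝ h x y < h y := by
  set γ : ℝ → Amb n := fun s => x + s • (y - x) with hγ
  -- The segment's direction is never radial, so `h` is strictly convex along it. The derivative at
  -- 0 is therefore less than the mean slope, and Euler's identity at `x` turns this into the claim.
  have hind (s : ℝ) : LinearIndependent ℝ ![γ s, y - x] := by
    rw [LinearIndependent.pair_iff] at hxy ⊢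
    intro a b hab
    have h1 : (a - (a * s + b)) • x + (a * s + b) • y = 0 := by
      rw [← hab]; simp only [hγ]; module
    obtain ⟨h2, h3⟩ := hxy _ _ h1
    have ha : a = 0 := by linarith
    refine ⟨ha, ?_⟩
    rw [ha] at h3; linarith
  have hne (s : ℝ) : γ s ≠ 0 := (hind s).ne_zero 0
  have hγd (s : ℝ) : HasDerivAt γ (y - x) s := by
    have := ((hasDerivAt_id s).smul_const (y - x)).const_add x
    rwa [one_smul] at this
  set φ : ℝ → ℝ := fun s => fderiv ℝ h (γ s) (y - x) with hφ
  have hd1 (s : ℝ) : HasDerivAt (fun s => h (γ s)) (φ s) s :=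
    (hh.differentiableAt (hne s)).hasFDerivAt.comp_hasDerivAt s (hγd s)
  have hd2 (s : ℝ) : HasDerivAt φ (hess h (γ s) (y - x) (y - x)) s := by
    have := ((hh.differentiableAt_fderiv (hne s)).hasFDerivAt.comp_hasDerivAt s (hγd s)).clm_apply
      (hasDerivAt_const s (y - x))
    rwa [map_zero, add_zero] at this
  have hmono : StrictMono φ := strictMono_of_hasDerivAt_pos hd2 fun s => hpos _ _ (hind s)
  obtain ⟨s, hs, hs'⟩ := exists_hasDerivAt_eq_slope (fun s => h (γ s)) φ zero_lt_one
    (fun s _ => (hd1 s).continuousAt.continuousWithinAt) fun s _ => hd1 s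
  have h0 : φ 0 < φ s := hmono hs.1
  have hx0 : x ≠ 0 := hxy.ne_zero 0
  rw [hs'] at h0
  simp only [hφ, hγ, zero_smul, add_zero, one_smul, add_sub_cancel, sub_zero, div_one, map_sub,
    hh.fderiv_self hx0] at h0
  linarith

theorem exists_linearIndependent (hn : 1 ≤ n) {x : Amb n} (hx : x ≠ 0) :
    ∃ y, LinearIndependent ℝ ![x, y] :=
  exists_linearIndependent_pair_of_one_lt_finrank (by simp; omega) hx

theorem fderiv_le (hn : 1 ≤ n) (hh : IsConic h)
    (hpos : ∀ x ξ : Amb n, LinearIndependent ℝ ![x, ξ] → 0 < hess h x ξ ξ)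
    {x y : Amb n} (hx : x ≠ 0) (hy : y ≠ 0) : fderiv ℝ h x y ≤ h y := by
  by_cases hxy : LinearIndependent ℝ ![x, y]
  · exact (hh.fderiv_lt_of_linearIndependent hpos hxy).le
  · rw [LinearIndependent.pair_iff' hx] at hxy
    push Not at hxy
    obtain ⟨a, rfl⟩ := hxy
    have ha : a ≠ 0 := fun h0 => hy (by rw [h0, zero_smul])
    rw [map_smul, hh.fderiv_self hx, smul_eq_mul]
    rcases lt_or_gt_of_ne ha with ha | ha
    · have h1 : h (a • x) = -a * h (-x) := by
        rw [← hh.homogeneous (-a) (by linarith) _ (neg_ne_zero.2 hx), smul_neg, neg_smul, neg_neg]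
      -- For `y` on the opposite ray, `h x + h (-x) > 0` is needed. It follows by adding the strict
      -- inequalities for `x` and `-x` at a third point `w` off their line.
      obtain ⟨w, hw⟩ := exists_linearIndependent hn hx
      have hw' : LinearIndependent ℝ ![w, x] := LinearIndependent.pair_symm_iff.1 hw
      have hw'' : LinearIndependent ℝ ![w, -x] := by
        rw [LinearIndependent.pair_iff] at hw' ⊢
        intro s t hst
        obtain ⟨h2, h3⟩ := hw' s (-t) (by rw [← hst]; module)
        exact ⟨h2, by linarith⟩
      have h2 := hh.fderiv_lt_of_linearIndependent hpos hw'
      have h3 := hh.fderiv_lt_of_linearIndependent hpos hw''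
      rw [map_neg] at h3
      rw [h1]
      nlinarith
    · rw [hh.homogeneous a ha x hx]

/-- After subtracting a linear function, a function whose Hessian is definite transversally to the
radial direction becomes positive. -/
theorem exists_sub_linear_pos (hn : 1 ≤ n) (hh : IsConic h)
    (hpos : ∀ x ξ : Amb n, LinearIndependent ℝ ![x, ξ] → 0 < hess h x ξ ξ) :
    ∃ c : Amb n →L[ℝ] ℝ, ∀ x, x ≠ 0 → 0 < h x - c x := by
  have hne : (EuclideanSpace.single 0 1 : Amb n) ≠ 0 := by simp
  obtain ⟨x₁, hx₁⟩ := exists_linearIndependent hn hne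
  set x₀ : Amb n := EuclideanSpace.single 0 1
  -- The average of two supporting functionals at independent points: `y` cannot lie on both lines,
  -- so at least one of the two inequalities is strict.
  refine ⟨(1 / 2 : ℝ) • (fderiv ℝ h x₀ + fderiv ℝ h x₁), fun y hy => ?_⟩
  have h0 := hh.fderiv_le hn hpos hne hy
  have h1 : fderiv ℝ h x₁ y ≤ h y := hh.fderiv_le hn hpos (hx₁.ne_zero 1) hy
  simp only [smul_apply, add_apply, smul_eq_mul]
  by_cases hi : LinearIndependent ℝ ![x₀, y]
  · have := hh.fderiv_lt_of_linearIndependent hpos hi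
    linarith
  · have hi' : LinearIndependent ℝ ![x₁, y] := by
      rw [LinearIndependent.pair_iff' hne] at hi
      push Not at hi
      obtain ⟨a, rfl⟩ := hi
      have ha : a ≠ 0 := fun h0 => hy (by rw [h0, zero_smul])
      rw [LinearIndependent.pair_iff] at hx₁ ⊢
      intro s t hst
      obtain ⟨h2, h3⟩ := hx₁ (t * a) s (by rw [← hst]; module)
      exact ⟨h3, (mul_eq_zero.1 h2).resolve_right ha⟩
    have h2 : fderiv ℝ h x₁ y < h y := hh.fderiv_lt_of_linearIndependent hpos hi'
    linarith

end IsConic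

end AnisoMinkowski

end

/-! ### Radial and tangential splitting, and radial cutoffs -/

section

namespace AnisoMinkowski

open Filter Topology MeasureTheory

theorem exists_orthonormalBasis_cons {n : ℕ} {x : Amb n} (hx : x ≠ 0) {e : Fin n → Amb n}
    (he : Orthonormal ℝ e) (hxe : ∀ i, inner ℝ x (e i) = 0) :
    ∃ b : OrthonormalBasis (Fin (n + 1)) ℝ (Amb n), b 0 = ‖x‖⁻¹ • x ∧ ∀ i, b i.succ = e i := by
  have ho : Orthonormal ℝ (Fin.cons (‖x‖⁻¹ • x) e : Fin (n + 1) → Amb n) := by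
    have hx' : ‖x‖ ≠ 0 := norm_ne_zero_iff.2 hx
    refine ⟨fun i => ?_, fun i j hij => ?_⟩
    · refine Fin.cases ?_ (fun i => ?_) i
      · simp [norm_smul, hx']
      · simpa using he.1 i
    · revert hij
      refine Fin.cases ?_ (fun i => ?_) i <;> refine Fin.cases ?_ (fun j => ?_) j
      · simp
      · simp [inner_smul_left, hxe]
      · simp [inner_smul_right, real_inner_comm, hxe]
      · intro hij
        simpa using he.2 (fun h => hij (by rw [h]))
  have hcard : Fintype.card (Fin (n + 1)) = Module.finrank ℝ (Amb n) := by simp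
  refine ⟨(basisOfOrthonormalOfCardEqFinrank ho hcard).toOrthonormalBasis (by simpa using ho),
    by simp, by simp⟩

/-- The matrix of a bilinear form with respect to a family of vectors. -/
def gramMat {n : ℕ} (L : Amb n →L[ℝ] Amb n →L[ℝ] ℝ) (e : Fin n → Amb n) :
    Matrix (Fin n) (Fin n) ℝ :=
  Matrix.of fun i j => L (e i) (e j)

theorem dotProduct_gramMat_mulVec {n : ℕ} (L : Amb n →L[ℝ] Amb n →L[ℝ] ℝ) (e : Fin n → Amb n)
    (c : Fin n → ℝ) :
    dotProduct c ((gramMat L e).mulVec c) = L (∑ i, c i • e i) (∑ i, c i • e i) := by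
  simp only [dotProduct, Matrix.mulVec, gramMat, Matrix.of_apply, map_sum, map_smul,
    sum_apply, smul_apply, smul_eq_mul]
  simp only [Finset.mul_sum]
  rw [Finset.sum_comm]
  refine Finset.sum_congr rfl fun i _ => Finset.sum_congr rfl fun j _ => by ring

theorem posDef_gramMat {n : ℕ} {L : Amb n →L[ℝ] Amb n →L[ℝ] ℝ} {e : Fin n → Amb n} {x : Amb n}
    (he : LinearIndependent ℝ e) (hxe : ∀ i, inner ℝ x (e i) = 0)
    (hsymm : ∀ ξ η, L ξ η = L η ξ) (hpos : ∀ ξ, ξ ≠ 0 → inner ℝ x ξ = 0 → 0 < L ξ ξ) :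
    (gramMat L e).PosDef := by
  refine Matrix.PosDef.of_dotProduct_mulVec_pos ?_ fun c hc => ?_
  · ext i j
    simp [gramMat, hsymm (e i)]
  · rw [star_trivial, dotProduct_gramMat_mulVec]
    refine hpos _ (fun h0 => hc ?_) ?_
    · exact funext (Fintype.linearIndependent_iff.1 he c h0)
    · simp [inner_sum, inner_smul_right, hxe]

/-- The radial part of `ξ` drops out of `L ξ ξ`, and the tangential part is nonzero because `ξ` is
not radial. -/
theorem apply_pos_of_gramMat_posDef {n : ℕ} {L : Amb n →L[ℝ] Amb n →L[ℝ] ℝ} {e : Fin n → Amb n}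
    {x : Amb n} (he : Orthonormal ℝ e) (hxe : ∀ i, inner ℝ x (e i) = 0)
    (hL : L x = 0) (hL' : ∀ ξ, L ξ x = 0) (hpos : (gramMat L e).PosDef) {ξ : Amb n}
    (hξ : LinearIndependent ℝ ![x, ξ]) : 0 < L ξ ξ := by
  have hx : x ≠ 0 := hξ.ne_zero 0
  obtain ⟨b, hb0, hb⟩ := exists_orthonormalBasis_cons hx he hxe
  have hexp : ξ = (inner ℝ (b 0) ξ * ‖x‖⁻¹) • x + ∑ i, inner ℝ (e i) ξ • e i := by
    conv_lhs => rw [← b.sum_repr' ξ, Fin.sum_univ_succ]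
    simp only [hb, hb0, smul_smul]
  set ζ := ∑ i, inner ℝ (e i) ξ • e i with hζ
  set a := inner ℝ (b 0) ξ * ‖x‖⁻¹
  have h1 : L ξ ξ = L ζ ζ := by
    rw [hexp]; simp [hL, hL']
  rw [h1, hζ, ← dotProduct_gramMat_mulVec L e fun i => inner ℝ (e i) ξ]
  have h2 := hpos.dotProduct_mulVec_pos (x := fun i => inner ℝ (e i) ξ) ?_
  · rwa [star_trivial] at h2
  · intro h0
    have hζ0 : ζ = 0 := by
      rw [hζ]; exact Finset.sum_eq_zero fun i _ => by rw [show inner ℝ (e i) ξ = 0 from congrFun h0 i, zero_smul]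
    rw [hζ0, add_zero] at hexp
    exact (LinearIndependent.pair_iff' hx).1 hξ a hexp.symm

theorem eq_zero_of_gramMat_eq_zero {n : ℕ} {L : Amb n →L[ℝ] Amb n →L[ℝ] ℝ} {e : Fin n → Amb n}
    {x : Amb n} (hx : x ≠ 0) (he : Orthonormal ℝ e) (hxe : ∀ i, inner ℝ x (e i) = 0)
    (hL : L x = 0) (hL' : ∀ ξ, L ξ x = 0) (h0 : gramMat L e = 0) : L = 0 := by
  obtain ⟨b, hb0, hb⟩ := exists_orthonormalBasis_cons hx he hxe
  refine ContinuousLinearMap.coe_injective (b.toBasis.ext fun i => ?_)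
  refine ContinuousLinearMap.coe_injective (b.toBasis.ext fun j => ?_)
  refine Fin.cases ?_ (fun i => ?_) i <;> refine Fin.cases ?_ (fun j => ?_) j
  · simp [hb0, hL]
  · simp [hb0, hL]
  · simp [hb0, hL']
  · simpa [hb, gramMat] using congrFun (congrFun h0 i) j

/-- In an orthonormal basis starting with `x / ‖x‖`, the hypothesis `hD` makes the first row of the
matrix zero off the diagonal. -/
theorem det_eq_mul_det_of_inner_eq_zero {n : ℕ} (D : Amb n →L[ℝ] Amb n) {x : Amb n} (hx : x ≠ 0)
    {e : Fin n → Amb n} (he : Orthonormal ℝ e) (hxe : ∀ i, inner ℝ x (e i) = 0)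
    (hD : ∀ i, inner ℝ (D (e i)) x = 0) :
    D.det = inner ℝ (D x) x / ‖x‖ ^ 2 *
      (Matrix.of fun i j => inner ℝ (D (e i)) (e j)).det := by
  obtain ⟨b, hb0, hb⟩ := exists_orthonormalBasis_cons hx he hxe
  have hM : ∀ i j, LinearMap.toMatrix b.toBasis b.toBasis (D : Amb n →ₗ[ℝ] Amb n) i j =
      inner ℝ (b i) (D (b j)) := by
    intro i j
    simp [LinearMap.toMatrix_apply, OrthonormalBasis.repr_apply_apply]
  rw [ContinuousLinearMap.det, ← LinearMap.det_toMatrix b.toBasis, Matrix.det_succ_row_zero,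
    Fin.sum_univ_succ, Finset.sum_eq_zero, add_zero, ← Matrix.det_transpose]
  · congr 1
    · rw [hM, hb0]
      simp only [Fin.val_zero, pow_zero, one_mul, map_smul, inner_smul_left, inner_smul_right,
        conj_trivial, real_inner_comm x]
      rw [div_eq_mul_inv, real_inner_comm, ← inv_pow]; ring
    · congr 1
      ext i j
      simp [hM, hb, real_inner_comm]
  · intro j _
    have : inner ℝ (b 0) (D (b j.succ)) = 0 := by
      rw [hb, hb0, inner_smul_left, real_inner_comm, hD, mul_zero]
    rw [hM, this]; simp

/-- The gradient of a function on the ambient space. -/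
abbrev grad {n : ℕ} (h : Amb n → ℝ) (x : Amb n) : Amb n :=
  (InnerProductSpace.toDual ℝ (Amb n)).symm (fderiv ℝ h x)

/-- The derivative of the map `Λ ∇h`. -/
theorem IsConic.hasFDerivAt_smul_grad {n : ℕ} {h : Amb n → ℝ} (hh : IsConic h) {l : Amb n → ℝ}
    {x : Amb n} (hx : x ≠ 0) (hl : DifferentiableAt ℝ l x) :
    ∃ D : Amb n →L[ℝ] Amb n, HasFDerivAt (fun y => l y • grad h y) D x ∧
      ∀ ξ η, inner ℝ (D ξ) η = l x * hess h x ξ η + fderiv ℝ l x ξ * fderiv ℝ h x η := by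
  have h1 : HasFDerivAt (grad h) _ x :=
    ((InnerProductSpace.toDual ℝ (Amb n)).symm.toContinuousLinearEquiv.toContinuousLinearMap.hasFDerivAt.comp
      x (hh.differentiableAt_fderiv hx).hasFDerivAt)
  refine ⟨_, hl.hasFDerivAt.smul h1, fun ξ η => ?_⟩
  simp only [add_apply, smul_apply, ContinuousLinearMap.smulRight_apply, inner_add_left,
    inner_smul_left, conj_trivial, InnerProductSpace.toDual_symm_apply]
  congr 2
  exact InnerProductSpace.toDual_symm_apply

/-- The Hessians kill `x` and the cutoffs have no tangential derivative, so the derivative preserves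
`x^⊥`. The radial entry comes from the radial derivatives of the cutoffs and Euler's identity. It is
affine in `t`, which the second difference later exploits. -/
theorem IsConic.det_fderiv_smul_grad_add {n : ℕ} {h f : Amb n → ℝ} (hh : IsConic h)
    (hf : IsConic f) {l m : Amb n → ℝ} {x : Amb n} (hx : x ≠ 0) (hl : DifferentiableAt ℝ l x)
    (hm : DifferentiableAt ℝ m x) {e : Fin n → Amb n} (he : Orthonormal ℝ e)
    (hxe : ∀ i, inner ℝ x (e i) = 0) (hle : ∀ i, fderiv ℝ l x (e i) = 0)
    (hme : ∀ i, fderiv ℝ m x (e i) = 0) (t : ℝ) :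
    (fderiv ℝ (fun y => l y • grad h y + t • (m y • grad f y)) x).det =
      (fderiv ℝ l x x * h x + t * (fderiv ℝ m x x * f x)) / ‖x‖ ^ 2 *
        (l x • gramMat (hess h x) e + (t * m x) • gramMat (hess f x) e).det := by
  obtain ⟨D₁, hD₁, h1⟩ := hh.hasFDerivAt_smul_grad hx hl
  obtain ⟨D₂, hD₂, h2⟩ := hf.hasFDerivAt_smul_grad hx hm
  have hD : HasFDerivAt (fun y => l y • grad h y + t • (m y • grad f y)) (D₁ + t • D₂) x :=
    hD₁.add (hD₂.const_smul t)
  have hin (ξ η : Amb n) : inner ℝ ((D₁ + t • D₂) ξ) η =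
      l x * hess h x ξ η + fderiv ℝ l x ξ * fderiv ℝ h x η +
        t * (m x * hess f x ξ η + fderiv ℝ m x ξ * fderiv ℝ f x η) := by
    simp only [add_apply, smul_apply, inner_add_left, inner_smul_left, conj_trivial, h1, h2]
  rw [hD.fderiv, det_eq_mul_det_of_inner_eq_zero _ hx he hxe]
  · congr 2
    · rw [hin, hh.hess_self hx, hf.hess_self hx, hh.fderiv_self hx, hf.fderiv_self hx]
      simp
    · ext i j
      simp only [Matrix.of_apply, hin, hle, hme, Matrix.add_apply, Matrix.smul_apply, gramMat,
        smul_eq_mul]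
      ring
  · intro i
    rw [hin, hh.hess_apply_self hx, hf.hess_apply_self hx, hle, hme]
    simp

/-- Here `l` is `‖x‖ ^ 2` times a wide bump and `m` is a narrower bump, both functions of `‖x‖ ^ 2`.
Near the support of `m`, `l` is exactly `‖x‖ ^ 2`, whence its positive radial derivative. -/
theorem exists_radial_cutoffs {n : ℕ} {x₀ : Amb n} (hx₀ : x₀ ≠ 0) :
    ∃ l m : Amb n → ℝ, ContDiff ℝ 1 l ∧ ContDiff ℝ 1 m ∧ HasCompactSupport l ∧
      HasCompactSupport m ∧ (0 : Amb n) ∉ tsupport l ∧ (0 : Amb n) ∉ tsupport m ∧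
      m x₀ = 1 ∧ (∀ x ∈ tsupport m, 0 < l x ∧ 0 < fderiv ℝ l x x) ∧
      ∀ x η, inner ℝ x η = 0 → fderiv ℝ l x η = 0 ∧ fderiv ℝ m x η = 0 := by
  have hR : 0 < ‖x₀‖ ^ 2 := by positivity
  set R := ‖x₀‖ ^ 2
  -- In the variable `s = ‖x‖ ^ 2`, `c` equals 1 within distance `R / 2` of `R`, leaving a margin `R
  -- / 4` around the support of `b`; its outer radius `3 * R / 4 < R` keeps the origin out.
  let b : ContDiffBump R := ⟨R / 8, R / 4, by linarith, by linarith⟩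
  let c : ContDiffBump R := ⟨R / 2, 3 * R / 4, by linarith, by linarith⟩
  have hcb : ContDiff ℝ 1 b := b.contDiff
  have hcc : ContDiff ℝ 1 c := c.contDiff
  set a : ℝ → ℝ := fun s => c s * s with ha
  have hca : ContDiff ℝ 1 a := hcc.mul contDiff_id
  have hsq : ContDiff ℝ 1 fun x : Amb n => ‖x‖ ^ 2 := contDiff_norm_sq ℝ
  have hder (p : ℝ → ℝ) (hp : ContDiff ℝ 1 p) (x η : Amb n) :
      fderiv ℝ (fun x : Amb n => p (‖x‖ ^ 2)) x η = deriv p (‖x‖ ^ 2) * (2 * inner ℝ x η) := by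
    have h1 := (hp.differentiable one_ne_zero (‖x‖ ^ 2)).hasDerivAt.comp_hasFDerivAt x
      (hasStrictFDerivAt_norm_sq x).hasFDerivAt
    have h2 := congrArg (fun L => L η) h1.fderiv
    refine h2.trans ?_
    simp
  have hsupp (p : ℝ → ℝ) (hp : ∀ s, 3 * R / 4 ≤ |s - R| → p s = 0) :
      tsupport (fun x : Amb n => p (‖x‖ ^ 2)) ⊆ {x | |‖x‖ ^ 2 - R| ≤ 3 * R / 4} := by
    refine closure_minimal (fun x hx => ?_) (isClosed_le (by fun_prop) continuous_const)
    by_contra h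
    exact hx (hp _ (not_le.1 h).le)
  have hcpt (p : ℝ → ℝ) (hp : ∀ s, 3 * R / 4 ≤ |s - R| → p s = 0) :
      HasCompactSupport (fun x : Amb n => p (‖x‖ ^ 2)) ∧
        (0 : Amb n) ∉ tsupport (fun x : Amb n => p (‖x‖ ^ 2)) := by
    refine ⟨HasCompactSupport.of_support_subset_isCompact
      (isCompact_closedBall (0 : Amb n) (2 * ‖x₀‖)) fun x hx => ?_, fun h0 => ?_⟩
    · have h1 : |‖x‖ ^ 2 - R| ≤ 3 * R / 4 := hsupp p hp (subset_tsupport _ hx)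
      have h2 := (abs_le.1 h1).2
      rw [mem_closedBall_zero_iff]
      refine le_of_sq_le_sq ?_ (by positivity)
      simp only [R] at h2
      nlinarith
    · have h1 := hsupp p hp h0
      simp only [Set.mem_ofPred_eq, norm_zero] at h1
      have := (abs_le.1 h1).1
      simp at this
      linarith
  have hb0 : ∀ s, R / 4 ≤ |s - R| → b s = 0 := fun s hs => b.zero_of_le_dist hs
  have hc0 : ∀ s, 3 * R / 4 ≤ |s - R| → c s = 0 := fun s hs => c.zero_of_le_dist hs
  have hb0' : ∀ s, 3 * R / 4 ≤ |s - R| → b s = 0 := fun s hs => hb0 s (by linarith)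
  have ha0 : ∀ s, 3 * R / 4 ≤ |s - R| → a s = 0 := fun s hs => by simp [ha, hc0 s hs]
  refine ⟨fun x => a (‖x‖ ^ 2), fun x => b (‖x‖ ^ 2), hca.comp hsq, hcb.comp hsq,
    (hcpt a ha0).1, (hcpt b hb0').1, (hcpt a ha0).2, (hcpt b hb0').2,
    b.one_of_mem_closedBall (by simp [R, b]; positivity), fun x hx => ?_, fun x η hη => ?_⟩
  · have h1 : |‖x‖ ^ 2 - R| ≤ R / 4 := by
      have : tsupport (fun x : Amb n => b (‖x‖ ^ 2)) ⊆ {x | |‖x‖ ^ 2 - R| ≤ R / 4} := by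
        refine closure_minimal (fun x hx => ?_) (isClosed_le (by fun_prop) continuous_const)
        by_contra h
        exact hx (hb0 _ (not_le.1 h).le)
      exact this hx
    have h2 : 0 < ‖x‖ ^ 2 := by linarith [(abs_le.1 h1).1]
    have h3 : a =ᶠ[𝓝 (‖x‖ ^ 2)] id := by
      filter_upwards [Metric.ball_mem_nhds (‖x‖ ^ 2) (show 0 < R / 4 by linarith)] with s hs
      have : c s = 1 := by
        refine c.one_of_mem_closedBall ?_
        rw [Metric.mem_ball, Real.dist_eq] at hs
        rw [Metric.mem_closedBall, Real.dist_eq]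
        have := abs_sub_le s (‖x‖ ^ 2) R
        simp only [c]
        linarith
      simp [ha, this]
    refine ⟨h2.trans_eq h3.self_of_nhds.symm, ?_⟩
    rw [hder a hca, h3.deriv_eq, deriv_id, real_inner_self_eq_norm_sq]
    linarith
  · rw [hder a hca, hder b hcb, hη]; simp

end AnisoMinkowski

end

/-! ### Infinitesimal rigidity -/

section

namespace AnisoMinkowski

open Filter Topology MeasureTheory

theorem eq_zero_of_integral_eq_zero_of_nonpos {n : ℕ} {f : Amb n → ℝ} (hf : Continuous f)
    (hc : HasCompactSupport f) (hnonpos : ∀ x, f x ≤ 0) (hint : ∫ x, f x = 0) : ∀ x, f x = 0 := by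
  have h1 : ∫ x, -f x = 0 := by rw [integral_neg, hint, neg_zero]
  have h2 := (integral_eq_zero_iff_of_nonneg (μ := volume) (f := fun x => -f x)
    (fun x => neg_nonneg.2 (hnonpos x)) (hf.neg.integrable_of_hasCompactSupport hc.neg)).1 h1
  have h3 := Continuous.ae_eq_iff_eq volume hf.neg continuous_zero |>.1 h2
  intro x
  simpa using congrFun h3 x

/-- The cutoff vanishes near the origin, the only point where `grad h` may be singular. -/
theorem contDiff_smul_grad {n : ℕ} {h : Amb n → ℝ} (hh : IsConic h) {l : Amb n → ℝ}
    (hl : ContDiff ℝ 1 l) (h0 : (0 : Amb n) ∉ tsupport l) :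
    ContDiff ℝ 1 fun y => l y • grad h y := by
  rw [contDiff_iff_contDiffAt]
  intro x
  by_cases hx : x = 0
  · subst hx
    refine contDiffAt_const (c := (0 : Amb n)) |>.congr_of_eventuallyEq ?_
    filter_upwards [(isClosed_tsupport l).isOpen_compl.mem_nhds h0] with y hy
    rw [image_eq_zero_of_notMem_tsupport hy, zero_smul]
  · exact hl.contDiffAt.smul ((InnerProductSpace.toDual ℝ
      (Amb n)).symm.toContinuousLinearEquiv.contDiff.contDiffAt.comp x (hh.contDiffAt_fderiv hx))

variable {n : ℕ} {h f : Amb n → ℝ}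

theorem eventually_radial_pos (hh : IsConic h) (hf : IsConic f) (hpos : ∀ x, x ≠ 0 → 0 < h x)
    {l m : Amb n → ℝ} (hl : ContDiff ℝ 1 l) (hm : ContDiff ℝ 1 m) {K : Set (Amb n)}
    (hK : IsCompact K) (hK0 : (0 : Amb n) ∉ K) (hlK : ∀ x ∈ K, 0 < fderiv ℝ l x x) :
    ∀ᶠ t : ℝ in 𝓝 0, ∀ x ∈ K, 0 < fderiv ℝ l x x * h x + t * (fderiv ℝ m x x * f x) := by
  refine hK.eventually_forall_of_forall_eventually fun x hx => ?_
  have hx0 : x ≠ 0 := fun h0 => hK0 (h0 ▸ hx)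
  have hc : ContinuousAt (fun z : ℝ × Amb n => fderiv ℝ l z.2 z.2 * h z.2 +
      z.1 * (fderiv ℝ m z.2 z.2 * f z.2)) (0, x) := by
    have hl1 : Continuous fun y => fderiv ℝ l y y :=
      (hl.continuous_fderiv one_ne_zero).clm_apply continuous_id
    have hm1 : Continuous fun y => fderiv ℝ m y y :=
      (hm.continuous_fderiv one_ne_zero).clm_apply continuous_id
    have hh1 : ContinuousAt h x := (hh.differentiableAt hx0).continuousAt
    have hf1 : ContinuousAt f x := (hf.differentiableAt hx0).continuousAt
    have h1 : ContinuousAt (fun y => fderiv ℝ l y y * h y) x := hl1.continuousAt.mul hh1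
    have h2 : ContinuousAt (fun y => fderiv ℝ m y y * f y) x := hm1.continuousAt.mul hf1
    exact (ContinuousAt.comp' (f := Prod.snd) (x := ((0 : ℝ), x)) h1 continuousAt_snd).add
      (continuousAt_fst.mul (ContinuousAt.comp' (f := Prod.snd) (x := ((0 : ℝ), x)) h2
        continuousAt_snd))
  refine hc.eventually (lt_mem_nhds ?_)
  simp only [zero_mul, add_zero]
  exact mul_pos (hlK x hx) (hpos x hx0)

theorem eventually_hess_pos (hh : IsConic h) (hf : IsConic f)
    (hpos : ∀ x ξ : Amb n, LinearIndependent ℝ ![x, ξ] → 0 < hess h x ξ ξ)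
    {l m : Amb n → ℝ} (hl : Continuous l) (hm : Continuous m) {K : Set (Amb n)}
    (hK : IsCompact K) (hK0 : (0 : Amb n) ∉ K) (hlK : ∀ x ∈ K, 0 < l x) :
    ∀ᶠ t : ℝ in 𝓝 0, ∀ x ∈ K, ∀ ξ, ξ ≠ 0 → inner ℝ x ξ = 0 →
      0 < l x * hess h x ξ ξ + t * m x * hess f x ξ ξ := by
  -- By scaling in `ξ` it is enough to treat unit tangential vectors over `K`. They form a compact
  -- set, on which positivity at `t = 0` persists uniformly for small `t`.
  set C : Set (Amb n × Amb n) := (K ×ˢ Metric.sphere 0 1) ∩ {p | inner ℝ p.1 p.2 = 0} with hC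
  have hCc : IsCompact C := (hK.prod (isCompact_sphere _ _)).inter_right
    (isClosed_eq (by fun_prop) continuous_const)
  have hev : ∀ᶠ t : ℝ in 𝓝 0, ∀ p ∈ C,
      0 < l p.1 * hess h p.1 p.2 p.2 + t * m p.1 * hess f p.1 p.2 p.2 := by
    refine hCc.eventually_forall_of_forall_eventually fun p hp => ?_
    have hx0 : p.1 ≠ 0 := fun h0 => hK0 (h0 ▸ hp.1.1)
    have hc : ContinuousAt (fun z : ℝ × (Amb n × Amb n) =>
        l z.2.1 * hess h z.2.1 z.2.2 z.2.2 + z.1 * m z.2.1 * hess f z.2.1 z.2.2 z.2.2) (0, p) := by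
      have hs : ContinuousAt (fun z : ℝ × (Amb n × Amb n) => z.2.1) (0, p) := by fun_prop
      have hs2 : ContinuousAt (fun z : ℝ × (Amb n × Amb n) => z.2.2) (0, p) := by fun_prop
      have h1 : ContinuousAt (fun z : ℝ × (Amb n × Amb n) => hess h z.2.1) (0, p) :=
        ContinuousAt.comp' (f := fun z : ℝ × (Amb n × Amb n) => z.2.1) (x := ((0 : ℝ), p))
          (hh.continuousAt_hess hx0) hs
      have h2 : ContinuousAt (fun z : ℝ × (Amb n × Amb n) => hess f z.2.1) (0, p) :=
        ContinuousAt.comp' (f := fun z : ℝ × (Amb n × Amb n) => z.2.1) (x := ((0 : ℝ), p))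
          (hf.continuousAt_hess hx0) hs
      have h3 : ContinuousAt (fun z : ℝ × (Amb n × Amb n) => l z.2.1) (0, p) := by fun_prop
      have h4 : ContinuousAt (fun z : ℝ × (Amb n × Amb n) => z.1 * m z.2.1) (0, p) := by fun_prop
      exact (h3.mul ((h1.clm_apply hs2).clm_apply hs2)).add
        (h4.mul ((h2.clm_apply hs2).clm_apply hs2))
    refine hc.eventually (lt_mem_nhds ?_)
    simp only [zero_mul, add_zero]
    refine mul_pos (hlK _ hp.1.1) (hpos _ _ ?_)
    have hn : ‖p.2‖ = 1 := by simpa using hp.1.2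
    have hp2 : p.2 ≠ 0 := fun h0 => by rw [h0, norm_zero] at hn; exact zero_ne_one hn
    rw [LinearIndependent.pair_iff' hx0]
    intro a ha
    have h5 : inner ℝ p.1 p.2 = 0 := hp.2
    rw [← ha, inner_smul_right, mul_eq_zero, inner_self_eq_zero] at h5
    rcases h5 with h5 | h5
    · rw [h5, zero_smul] at ha; exact hp2 ha.symm
    · exact hx0 h5
  filter_upwards [hev] with t ht x hx ξ hξ hxξ
  have hξ' : ‖ξ‖ ≠ 0 := norm_ne_zero_iff.2 hξ
  have h1 := ht (x, ‖ξ‖⁻¹ • ξ) ⟨⟨hx, by simp [norm_smul, hξ']⟩,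
    by change inner ℝ x (‖ξ‖⁻¹ • ξ) = 0; rw [inner_smul_right, hxξ, mul_zero]⟩
  simp only [map_smul, smul_apply, smul_eq_mul] at h1
  have h2 : 0 < (‖ξ‖⁻¹ * ‖ξ‖⁻¹) * (l x * hess h x ξ ξ + t * m x * hess f x ξ ξ) := by
    refine h1.trans_eq ?_; ring
  exact pos_of_mul_pos_right h2 (by positivity)

theorem trace_inv_smul_mul_smul_eq_zero {ι : Type*} [Fintype ι] [DecidableEq ι]
    {A B : Matrix ι ι ℝ} (hA : A.PosDef) {a : ℝ} (ha : 0 < a) (b : ℝ)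
    (htr : (A⁻¹ * B).trace = 0) : ((a • A)⁻¹ * (b • B)).trace = 0 := by
  have : (a • A)⁻¹ = a⁻¹ • A⁻¹ := by
    refine Matrix.inv_eq_left_inv ?_
    rw [Matrix.smul_mul, Matrix.mul_smul, smul_smul, inv_mul_cancel₀ ha.ne', one_smul,
      Matrix.nonsing_inv_mul _ (isUnit_iff_ne_zero.2 hA.det_pos.ne')]
  rw [this, Matrix.smul_mul, Matrix.mul_smul, Matrix.trace_smul, Matrix.trace_smul, htr]
  simp

theorem gramMat_add_smul (a b : ℝ) (L M : Amb n →L[ℝ] Amb n →L[ℝ] ℝ) (e : Fin n → Amb n) :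
    gramMat (a • L + b • M) e = a • gramMat L e + b • gramMat M e := by
  ext i j
  simp [gramMat]

theorem det_smul_gramMat_add_le (hh : IsConic h) (hf : IsConic f) {x : Amb n} (hx : x ≠ 0)
    {e : Fin n → Amb n} (he : Orthonormal ℝ e) (hxe : ∀ i, inner ℝ x (e i) = 0)
    (hA : (gramMat (hess h x) e).PosDef)
    (htr : ((gramMat (hess h x) e)⁻¹ * gramMat (hess f x) e).trace = 0) {a b : ℝ} (ha : 0 < a)
    (hab : ∀ ξ, ξ ≠ 0 → inner ℝ x ξ = 0 → 0 < a * hess h x ξ ξ + b * hess f x ξ ξ) :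
    (a • gramMat (hess h x) e + b • gramMat (hess f x) e).det ≤
      (a • gramMat (hess h x) e).det ∧
    ((a • gramMat (hess h x) e + b • gramMat (hess f x) e).det =
      (a • gramMat (hess h x) e).det → b = 0 ∨ hess f x = 0) := by
  have h1 := det_add_le_det (hA.smul ha) (B := b • gramMat (hess f x) e) ?_
    (trace_inv_smul_mul_smul_eq_zero hA ha _ htr)
  · refine ⟨h1.1, fun h2 => (smul_eq_zero.1 (h1.2 h2)).imp_right fun h3 => ?_⟩
    exact eq_zero_of_gramMat_eq_zero hx he hxe (hf.hess_self hx) (hf.hess_apply_self hx) h3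
  · rw [← gramMat_add_smul]
    refine posDef_gramMat he.linearIndependent hxe (fun ξ η => ?_) fun ξ hξ hxξ => hab ξ hξ hxξ
    change a * hess h x ξ η + b * hess f x ξ η = a * hess h x η ξ + b * hess f x η ξ
    rw [hh.hess_symm hx ξ, hf.hess_symm hx ξ]

/-- The Jacobian determinant of `l ∇h + t m ∇f`. -/
def jac (h f l m : Amb n → ℝ) (t : ℝ) (x : Amb n) : ℝ :=
  (fderiv ℝ (fun y => l y • grad h y + t • (m y • grad f y)) x).det

theorem det_zero_amb : (0 : Amb n →L[ℝ] Amb n).det = 0 := by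
  rw [ContinuousLinearMap.det, ContinuousLinearMap.toLinearMap_zero]; exact LinearMap.det_zero''

theorem jac_props (hh : IsConic h) (hf : IsConic f) {l m : Amb n → ℝ} (hl : ContDiff ℝ 1 l)
    (hm : ContDiff ℝ 1 m) (hlc : HasCompactSupport l) (hmc : HasCompactSupport m)
    (hl0 : (0 : Amb n) ∉ tsupport l) (hm0 : (0 : Amb n) ∉ tsupport m) (t : ℝ) :
    Continuous (jac h f l m t) ∧ HasCompactSupport (jac h f l m t) ∧
      ∫ x, jac h f l m t x = 0 ∧ jac h f l m t 0 = 0 := by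
  have hΨ : ContDiff ℝ 1 fun y => l y • grad h y + t • (m y • grad f y) :=
    (contDiff_smul_grad hh hl hl0).add ((contDiff_smul_grad hf hm hm0).const_smul t)
  have hΨc : HasCompactSupport fun y => l y • grad h y + t • (m y • grad f y) :=
    (hlc.smul_right (f' := grad h)).add
      ((hmc.smul_right (f' := grad f)).comp_left (g := fun v => t • v) (smul_zero t))
  refine ⟨ContinuousLinearMap.continuous_det.comp (hΨ.continuous_fderiv one_ne_zero),
    (hΨc.fderiv ℝ).comp_left (g := ContinuousLinearMap.det) det_zero_amb,
    integral_det_fderiv_eq_zero hΨ hΨc, ?_⟩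
  have : (fun y => l y • grad h y + t • (m y • grad f y)) =ᶠ[𝓝 0] fun _ => 0 := by
    filter_upwards [(isClosed_tsupport l).isOpen_compl.mem_nhds hl0,
      (isClosed_tsupport m).isOpen_compl.mem_nhds hm0] with y hy hy'
    rw [image_eq_zero_of_notMem_tsupport hy, image_eq_zero_of_notMem_tsupport hy']
    simp
  rw [jac, this.fderiv_eq, fderiv_fun_const]
  exact det_zero_amb

/-- The second difference in `t` of the Jacobian determinant has integral zero but is pointwise
nonpositive by the determinant inequality, so equality holds at `x₀`. -/
theorem hess_eq_zero_of_pos (hh : IsConic h) (hf : IsConic f)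
    (hhpos : ∀ x, x ≠ 0 → 0 < h x)
    (hyp : ∀ x : Amb n, x ≠ 0 → ∃ e : Fin n → Amb n, Orthonormal ℝ e ∧
      (∀ i, inner ℝ x (e i) = 0) ∧ (gramMat (hess h x) e).PosDef ∧
      ((gramMat (hess h x) e)⁻¹ * gramMat (hess f x) e).trace = 0) {x₀ : Amb n} (hx₀ : x₀ ≠ 0) :
    hess f x₀ = 0 := by
  have hpos : ∀ x ξ : Amb n, LinearIndependent ℝ ![x, ξ] → 0 < hess h x ξ ξ := by
    intro x ξ hxξ
    have hx : x ≠ 0 := hxξ.ne_zero 0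
    obtain ⟨e, he, hxe, hA, -⟩ := hyp x hx
    exact apply_pos_of_gramMat_posDef he hxe (hh.hess_self hx) (hh.hess_apply_self hx) hA hxξ
  obtain ⟨l, m, hl, hm, hlc, hmc, hl0, hm0, hmx₀, hlm, hrad⟩ := exists_radial_cutoffs hx₀
  obtain ⟨J, hJ⟩ : ∃ J, J = jac h f l m := ⟨_, rfl⟩
  have hJp (t : ℝ) := jac_props hh hf hl hm hlc hmc hl0 hm0 t
  rw [← hJ] at hJp
  have hJint (t : ℝ) : ∫ x, J t x = 0 := (hJp t).2.2.1
  have hJi (t : ℝ) : Integrable (J t) := (hJp t).1.integrable_of_hasCompactSupport (hJp t).2.1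
  have hmK0 : ∀ x ∈ tsupport m, 0 < fderiv ℝ l x x := fun x hx => (hlm x hx).2
  have hev := (eventually_radial_pos hh hf hhpos hl hm hmc.isCompact hm0 hmK0).and
    (eventually_hess_pos hh hf hpos hl.continuous hm.continuous hmc.isCompact hm0
      fun x hx => (hlm x hx).1)
  have hneg : Tendsto (fun t : ℝ => -t) (𝓝 0) (𝓝 0) := by
    simpa using (continuous_neg (G := ℝ)).tendsto 0
  -- A nonzero `t` such that the positivity statements hold for both `t` and `-t`.
  obtain ⟨t, ⟨⟨ht1, ht2⟩, ⟨ht3, ht4⟩⟩, ht0⟩ := ((((hev.and (hneg.eventually hev)).filter_mono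
    nhdsWithin_le_nhds).and (self_mem_nhdsWithin (s := {(0 : ℝ)}ᶜ))).exists)
  have hformula (s : ℝ) {x : Amb n} (hx : x ≠ 0) {e : Fin n → Amb n} (he : Orthonormal ℝ e)
      (hxe : ∀ i, inner ℝ x (e i) = 0) : J s x =
        (fderiv ℝ l x x * h x + s * (fderiv ℝ m x x * f x)) / ‖x‖ ^ 2 *
        (l x • gramMat (hess h x) e + (s * m x) • gramMat (hess f x) e).det := by
    rw [hJ]
    exact hh.det_fderiv_smul_grad_add hf hx (hl.differentiable one_ne_zero x)
      (hm.differentiable one_ne_zero x) he hxe (fun i => (hrad x _ (hxe i)).1)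
      (fun i => (hrad x _ (hxe i)).2) s
  have hsplit {x : Amb n} (hx : x ∈ tsupport m) :
      J t x + J (-t) x - 2 * J 0 x ≤ 0 ∧ (J t x + J (-t) x - 2 * J 0 x = 0 →
        t * m x = 0 ∨ hess f x = 0) := by
    have hx0 : x ≠ 0 := fun h0 => hm0 (h0 ▸ hx)
    obtain ⟨e, he, hxe, hA, htr⟩ := hyp x hx0
    have h1 := det_smul_gramMat_add_le hh hf hx0 he hxe hA htr (hlm x hx).1 (ht2 x hx)
    have h2 := det_smul_gramMat_add_le hh hf hx0 he hxe hA htr (hlm x hx).1 (ht4 x hx)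
    have hsq : 0 < ‖x‖ ^ 2 := by positivity
    have h3 := div_pos (ht1 x hx) hsq
    have h4 := div_pos (ht3 x hx) hsq
    rw [hformula t hx0 he hxe, hformula (-t) hx0 he hxe, hformula 0 hx0 he hxe]
    set δ := (l x • gramMat (hess h x) e + (t * m x) • gramMat (hess f x) e).det
    set δ' := (l x • gramMat (hess h x) e + (-t * m x) • gramMat (hess f x) e).det
    simp only [zero_mul, zero_smul, add_zero]
    set δ₀ := (l x • gramMat (hess h x) e).det
    set a := (fderiv ℝ l x x * h x + t * (fderiv ℝ m x x * f x)) / ‖x‖ ^ 2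
    set a' := (fderiv ℝ l x x * h x + -t * (fderiv ℝ m x x * f x)) / ‖x‖ ^ 2
    -- The radial factor is affine in `t`, so its value at 0 is the mean of those at `±t`; the
    -- second difference becomes a positive combination of `δ - δ₀` and `δ' - δ₀`.
    have h5 : fderiv ℝ l x x * h x / ‖x‖ ^ 2 = (a + a') / 2 := by
      simp only [a, a']; ring
    have h6 : a * δ + a' * δ' - 2 * (fderiv ℝ l x x * h x / ‖x‖ ^ 2 * δ₀) =
        a * (δ - δ₀) + a' * (δ' - δ₀) := by rw [h5]; ring
    have h7 : a * (δ - δ₀) ≤ 0 := mul_nonpos_of_nonneg_of_nonpos h3.le (sub_nonpos.2 h1.1)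
    have h8 : a' * (δ' - δ₀) ≤ 0 := mul_nonpos_of_nonneg_of_nonpos h4.le (sub_nonpos.2 h2.1)
    rw [h6]
    refine ⟨add_nonpos h7 h8, fun h9 => ?_⟩
    have h10 : a * (δ - δ₀) = 0 := by linarith
    exact h1.2 (sub_eq_zero.1 ((mul_eq_zero.1 h10).resolve_left h3.ne'))
  have hnonpos : ∀ x, J t x + J (-t) x - 2 * J 0 x ≤ 0 := by
    intro x
    by_cases hx : x ∈ tsupport m
    · exact (hsplit hx).1
    -- Off the support of `m` the three Jacobians coincide.
    · rcases eq_or_ne x 0 with rfl | hx0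
      · simp [(hJp _).2.2.2]
      · obtain ⟨e, he, hxe, -⟩ := hyp x hx0
        have h1 : m x = 0 := image_eq_zero_of_notMem_tsupport hx
        have h2 : fderiv ℝ m x = 0 :=
          image_eq_zero_of_notMem_tsupport fun h => hx (tsupport_fderiv_subset ℝ h)
        simp only [hformula _ hx0 he hxe, h1, h2, zero_apply, zero_mul, mul_zero, add_zero]
        linarith
  have hint : ∫ x, (J t x + J (-t) x - 2 * J 0 x) = 0 := by
    have h1 : Integrable (fun x => J t x + J (-t) x) := (hJi t).add (hJi (-t))
    have h2 : Integrable (fun x => 2 * J 0 x) := (hJi 0).const_mul 2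
    rw [integral_sub h1 h2, integral_add (hJi t) (hJi (-t)), integral_const_mul, hJint, hJint,
      hJint]
    simp
  have hcs : HasCompactSupport (fun x => J t x + J (-t) x - 2 * J 0 x) :=
    HasCompactSupport.sub (f := fun x => J t x + J (-t) x) (f' := fun x => 2 * J 0 x)
      ((hJp t).2.1.add (hJp (-t)).2.1)
      ((hJp 0).2.1.comp_left (g := fun r => 2 * r) (mul_zero 2))
  have hct : Continuous (fun x => J t x + J (-t) x - 2 * J 0 x) :=
    Continuous.sub (f := fun x => J t x + J (-t) x) (g := fun x => 2 * J 0 x)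
      ((hJp t).1.add (hJp (-t)).1) (continuous_const.mul (hJp 0).1)
  have hzero := eq_zero_of_integral_eq_zero_of_nonpos hct hcs hnonpos hint x₀
  have hx₀m : x₀ ∈ tsupport m := subset_tsupport m (by simp [hmx₀])
  refine ((hsplit hx₀m).2 hzero).resolve_left ?_
  rw [hmx₀, mul_one]
  exact ht0

/-- Infinitesimal rigidity: if the trace of the Hessian of `f` relative to the Hessian of `h`
vanishes, then `f` is linear. -/
theorem exists_eq_linear (hn : 1 ≤ n) (hh : IsConic h) (hf : IsConic f)
    (hyp : ∀ x : Amb n, x ≠ 0 → ∃ e : Fin n → Amb n, Orthonormal ℝ e ∧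
      (∀ i, inner ℝ x (e i) = 0) ∧ (gramMat (hess h x) e).PosDef ∧
      ((gramMat (hess h x) e)⁻¹ * gramMat (hess f x) e).trace = 0) :
    ∃ a : Amb n →L[ℝ] ℝ, ∀ x, x ≠ 0 → f x = a x := by
  have hpos : ∀ x ξ : Amb n, LinearIndependent ℝ ![x, ξ] → 0 < hess h x ξ ξ := by
    intro x ξ hxξ
    have hx : x ≠ 0 := hxξ.ne_zero 0
    obtain ⟨e, he, hxe, hA, -⟩ := hyp x hx
    exact apply_pos_of_gramMat_posDef he hxe (hh.hess_self hx) (hh.hess_apply_self hx) hA hxξ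
  obtain ⟨c, hc⟩ := hh.exists_sub_linear_pos hn hpos
  have hf0 : ∀ x : Amb n, x ≠ 0 → hess f x = 0 := fun x hx =>
    hess_eq_zero_of_pos (hh.sub_linear c) hf hc (fun y hy => by
      rw [hh.hess_sub_linear c hy]; exact hyp y hy) hx
  have hconn : IsPreconnected ({0}ᶜ : Set (Amb n)) :=
    (isConnected_compl_singleton_of_one_lt_rank (by
      rw [rank_eq_card_basis (EuclideanSpace.basisFun (Fin (n + 1)) ℝ).toBasis]
      simp only [Fintype.card_fin]
      exact_mod_cast (by omega : 1 < n + 1)) 0).isPreconnected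
  have hx₁ : (EuclideanSpace.single 0 1 : Amb n) ∈ ({0}ᶜ : Set (Amb n)) := by simp
  refine ⟨fderiv ℝ f (EuclideanSpace.single 0 1), fun x hx => ?_⟩
  rw [← hf.fderiv_self hx]
  congr 1
  exact isOpen_compl_singleton.is_const_of_fderiv_eq_zero (𝕜 := ℝ) hconn
    (fun y hy => (hf.differentiableAt_fderiv hy).differentiableWithinAt)
    (fun y hy => hf0 y hy) hx hx₁

end AnisoMinkowski

end

/-! ### Minkowski norms and the Legendre transformation -/

section

namespace AnisoMinkowski

open Filter Topology

theorem two_le_infty : (2 : WithTop ℕ∞) ≤ ∞ :=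
  WithTop.coe_le_coe.2 (le_top : (2 : ℕ∞) ≤ ⊤)

namespace IsMinkowskiNorm

variable {n : ℕ} {F : Amb n → ℝ}

theorem contDiffAt (hF : IsMinkowskiNorm F) {x : Amb n} (hx : x ≠ 0) : ContDiffAt ℝ ∞ F x :=
  hF.smooth.contDiffAt (isOpen_compl_singleton.mem_nhds hx)

theorem differentiableAt (hF : IsMinkowskiNorm F) {x : Amb n} (hx : x ≠ 0) :
    DifferentiableAt ℝ F x :=
  (hF.contDiffAt hx).differentiableAt (by simp)

theorem contDiffAt_halfSq (hF : IsMinkowskiNorm F) {x : Amb n} (hx : x ≠ 0) :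
    ContDiffAt ℝ ∞ (halfSq F) x :=
  contDiffAt_const.mul ((hF.contDiffAt hx).pow 2)

theorem contDiffAt_fderiv_halfSq (hF : IsMinkowskiNorm F) {x : Amb n} (hx : x ≠ 0) :
    ContDiffAt ℝ ∞ (fderiv ℝ (halfSq F)) x :=
  (hF.contDiffAt_halfSq hx).fderiv_right (by simp)

theorem contDiffAt_hess_halfSq (hF : IsMinkowskiNorm F) {x : Amb n} (hx : x ≠ 0) :
    ContDiffAt ℝ ∞ (hess (halfSq F)) x :=
  (hF.contDiffAt_fderiv_halfSq hx).fderiv_right (by simp)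

theorem fderiv_halfSq (hF : IsMinkowskiNorm F) {x : Amb n} (hx : x ≠ 0) :
    fderiv ℝ (halfSq F) x = F x • fderiv ℝ F x := by
  have h1 := ((hF.differentiableAt hx).hasFDerivAt.pow 2).const_mul (1 / 2 : ℝ)
  refine HasFDerivAt.fderiv (h1.congr_fderiv ?_)
  ext ξ
  simp
  ring

theorem fderiv_self (hF : IsMinkowskiNorm F) {x : Amb n} (hx : x ≠ 0) : fderiv ℝ F x x = F x := by
  simpa using fderiv_self_of_homogeneous 1
    (fun t ht => by simpa using hF.homogeneous t ht x) (hF.differentiableAt hx)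

theorem fderiv_halfSq_smul (hF : IsMinkowskiNorm F) {t : ℝ} (ht : 0 < t) {x : Amb n} (hx : x ≠ 0) :
    fderiv ℝ (halfSq F) (t • x) = t • fderiv ℝ (halfSq F) x := by
  have := fderiv_smul_of_homogeneous (f := halfSq F) ht (c := t ^ 2)
    (fun y _ => by simp only [halfSq, hF.homogeneous t ht y, smul_eq_mul]; ring) hx
    fun y hy => (hF.contDiffAt_halfSq hy).differentiableAt (by simp)
  rw [this]
  congr 1
  field_simp

theorem G_self_left (hF : IsMinkowskiNorm F) {x : Amb n} (hx : x ≠ 0) (η : Amb n) :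
    G F x x η = fderiv ℝ (halfSq F) x η := by
  have := fderiv_self_of_homogeneous (f := fderiv ℝ (halfSq F)) 1
    (fun t ht => by simpa using hF.fderiv_halfSq_smul ht hx)
    ((hF.contDiffAt_fderiv_halfSq hx).differentiableAt (by simp))
  rw [G, this]; simp

theorem G_symm (hF : IsMinkowskiNorm F) {x : Amb n} (hx : x ≠ 0) (ξ η : Amb n) :
    G F x ξ η = G F x η ξ :=
  ((hF.contDiffAt_halfSq hx).isSymmSndFDerivAt (by simpa using two_le_infty)) ξ η

theorem G_self_right (hF : IsMinkowskiNorm F) {x : Amb n} (hx : x ≠ 0) (ξ : Amb n) :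
    G F x ξ x = fderiv ℝ (halfSq F) x ξ := by
  rw [hF.G_symm hx, hF.G_self_left hx]

theorem fderiv_halfSq_self (hF : IsMinkowskiNorm F) {x : Amb n} (hx : x ≠ 0) :
    fderiv ℝ (halfSq F) x x = F x ^ 2 := by
  rw [hF.fderiv_halfSq hx, smul_apply, hF.fderiv_self hx, smul_eq_mul, sq]

end IsMinkowskiNorm

/-- The Legendre transformation `x ↦ ∇(½F²)(x)`. -/
def legendre {n : ℕ} (F : Amb n → ℝ) (x : Amb n) : Amb n := grad (halfSq F) x

theorem inner_legendre {n : ℕ} (F : Amb n → ℝ) (x η : Amb n) :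
    inner ℝ (legendre F x) η = fderiv ℝ (halfSq F) x η :=
  InnerProductSpace.toDual_symm_apply

namespace IsMinkowskiNorm

variable {n : ℕ} {F : Amb n → ℝ}

theorem contDiffAt_legendre (hF : IsMinkowskiNorm F) {x : Amb n} (hx : x ≠ 0) :
    ContDiffAt ℝ ∞ (legendre F) x :=
  (InnerProductSpace.toDual ℝ (Amb n)).symm.toContinuousLinearEquiv.contDiff.contDiffAt.comp x
    (hF.contDiffAt_fderiv_halfSq hx)

theorem inner_fderiv_legendre (hF : IsMinkowskiNorm F) {x : Amb n} (hx : x ≠ 0) (ξ η : Amb n) :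
    inner ℝ (fderiv ℝ (legendre F) x ξ) η = G F x ξ η := by
  have h1 : HasFDerivAt (legendre F) _ x :=
    ((InnerProductSpace.toDual ℝ (Amb n)).symm.toContinuousLinearEquiv.toContinuousLinearMap.hasFDerivAt.comp
      x ((hF.contDiffAt_fderiv_halfSq hx).differentiableAt (by simp)).hasFDerivAt)
  rw [h1.fderiv]
  exact InnerProductSpace.toDual_symm_apply

theorem legendre_smul (hF : IsMinkowskiNorm F) {t : ℝ} (ht : 0 < t) {x : Amb n} (hx : x ≠ 0) :
    legendre F (t • x) = t • legendre F x := by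
  simp [legendre, grad, hF.fderiv_halfSq_smul ht hx]

theorem inner_legendre_self_pos (hF : IsMinkowskiNorm F) {x : Amb n} (hx : x ≠ 0) :
    0 < inner ℝ (legendre F x) x := by
  rw [inner_legendre, hF.fderiv_halfSq_self hx]
  have := hF.pos x hx
  positivity

theorem legendre_ne_zero (hF : IsMinkowskiNorm F) {x : Amb n} (hx : x ≠ 0) : legendre F x ≠ 0 := by
  intro h
  have := hF.inner_legendre_self_pos hx
  rw [h, inner_zero_left] at this
  exact lt_irrefl _ this

/-- The Legendre map is strictly monotone: the derivative of `⟨legendre F (γ s), y - x⟩` along a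
segment is a value of the definite form `G`. -/
theorem legendre_injOn (hF : IsMinkowskiNorm F) : Set.InjOn (legendre F) {0}ᶜ := by
  intro x hx y hy hxy
  by_contra hne
  set γ : ℝ → Amb n := fun s => x + s • (y - x) with hγ
  have hγd (s : ℝ) : HasDerivAt γ (y - x) s := by
    have := ((hasDerivAt_id s).smul_const (y - x)).const_add x
    rwa [one_smul] at this
  by_cases h0 : ∀ s ∈ Set.Icc (0 : ℝ) 1, γ s ≠ 0
  · set φ : ℝ → ℝ := fun s => inner ℝ (legendre F (γ s)) (y - x) with hφ
    have hd (s : ℝ) (hs : s ∈ Set.Icc (0 : ℝ) 1) :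
        HasDerivAt φ (G F (γ s) (y - x) (y - x)) s := by
      have h1 := ((hF.contDiffAt_legendre (h0 s hs)).differentiableAt
        (by simp)).hasFDerivAt.comp_hasDerivAt s (hγd s)
      have h2 := h1.inner ℝ (hasDerivAt_const s (y - x))
      refine h2.congr_deriv ?_
      rw [inner_zero_right, zero_add, hF.inner_fderiv_legendre (h0 s hs)]
    obtain ⟨s, hs, hs'⟩ := exists_hasDerivAt_eq_slope φ _ zero_lt_one
      (fun s hs => (hd s hs).continuousAt.continuousWithinAt)
      fun s hs => hd s (Set.Ioo_subset_Icc_self hs)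
    have h1 := hF.elliptic _ (h0 s (Set.Ioo_subset_Icc_self hs)) _ (sub_ne_zero.2 (Ne.symm hne))
    rw [hs'] at h1
    simp [hφ, hγ, hxy] at h1
  -- If the segment meets the origin, where `G` is not controlled, then `x` and `y` are opposite,
  -- and a common image would have to pair positively with both.
  · push Not at h0
    obtain ⟨s, hs, hs0⟩ := h0
    have h1 : (1 - s) • x + s • y = 0 := by rw [← hs0]; simp only [hγ]; module
    have h2 := congrArg (fun w => inner ℝ (legendre F x) w) h1
    have h3 := hF.inner_legendre_self_pos hx
    have h4 := hF.inner_legendre_self_pos hy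
    rw [← hxy] at h4
    simp only [inner_add_right, inner_smul_right, inner_zero_right] at h2
    rcases hs.1.eq_or_lt with h5 | h5
    · rw [← h5] at h2; linarith
    · have := mul_pos h5 h4
      have := mul_nonneg (sub_nonneg.2 hs.2) h3.le
      linarith

/-- A maximizer `z` of `⟨p, x⟩ / F x` on the sphere satisfies `p = M ∇F(z)`. Since `legendre F z = F
z • ∇F(z)`, the preimage of `p` is `z` rescaled by `M / F z`. -/
theorem legendre_surjOn (hF : IsMinkowskiNorm F) : Set.SurjOn (legendre F) {0}ᶜ {0}ᶜ := by
  intro p hp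
  have hp0 : p ≠ 0 := hp
  have hpn : ‖p‖ ≠ 0 := norm_ne_zero_iff.2 hp0
  have hsph : ∀ z ∈ Metric.sphere (0 : Amb n) 1, z ≠ 0 := by
    rintro z hz rfl
    simp at hz
  obtain ⟨z, hz, hmax⟩ := (isCompact_sphere (0 : Amb n) 1).exists_isMaxOn
    (f := fun x => inner ℝ p x / F x) ⟨‖p‖⁻¹ • p, by simp [norm_smul, hpn]⟩ (by
      intro x hx
      have hx0 := hsph x hx
      exact (ContinuousAt.div (by fun_prop) (hF.differentiableAt hx0).continuousAt
        (hF.pos x hx0).ne').continuousWithinAt)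
  have hz0 := hsph z hz
  set M := inner ℝ p z / F z with hM
  have hle : ∀ x : Amb n, x ≠ 0 → inner ℝ p x ≤ M * F x := by
    intro x hx
    have hxn : 0 < ‖x‖⁻¹ := inv_pos.2 (norm_pos_iff.2 hx)
    have h1 : inner ℝ p (‖x‖⁻¹ • x) / F (‖x‖⁻¹ • x) ≤ M :=
      hmax (by simp [norm_smul, norm_ne_zero_iff.2 hx])
    rw [inner_smul_right, hF.homogeneous _ hxn, mul_div_mul_left _ _ hxn.ne',
      div_le_iff₀ (hF.pos x hx)] at h1
    exact h1
  have hMpos : 0 < M := by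
    have h1 := hle p hp0
    rw [real_inner_self_eq_norm_sq] at h1
    have h2 : 0 < M * F p := lt_of_lt_of_le (by positivity) h1
    exact pos_of_mul_pos_left h2 (hF.pos p hp0).le
  have hloc : IsLocalMax (fun x => inner ℝ p x - M * F x) z := by
    filter_upwards [eventually_ne_zero hz0] with x hx
    have h1 : inner ℝ p z - M * F z = 0 := by
      rw [hM, div_mul_cancel₀ _ (hF.pos z hz0).ne', sub_self]
    rw [h1]
    exact sub_nonpos.2 (hle x hx)
  have hder : HasFDerivAt (fun x => inner ℝ p x - M * F x) (innerSL ℝ p - M • fderiv ℝ F z) z :=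
    (innerSL ℝ p).hasFDerivAt.sub ((hF.differentiableAt hz0).hasFDerivAt.const_mul M)
  have hcrit := hloc.hasFDerivAt_eq_zero hder
  have hFz := hF.pos z hz0
  refine ⟨(M / F z) • z, smul_ne_zero (div_pos hMpos hFz).ne' hz0, ?_⟩
  rw [hF.legendre_smul (div_pos hMpos hFz) hz0]
  refine ext_inner_right ℝ fun η => ?_
  have h1 := congrArg (fun L => L η) hcrit
  simp only [sub_apply, innerSL_apply_apply, smul_apply, smul_eq_mul, zero_apply] at h1
  rw [inner_smul_left, inner_legendre, hF.fderiv_halfSq hz0, smul_apply, smul_eq_mul, conj_trivial,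
    sub_eq_zero.1 h1]
  field_simp

end IsMinkowskiNorm

/-- The inverse of the Legendre transformation. -/
def legendreInv {n : ℕ} (F : Amb n → ℝ) : Amb n → Amb n :=
  Function.invFunOn (legendre F) {0}ᶜ

namespace IsMinkowskiNorm

variable {n : ℕ} {F : Amb n → ℝ}

theorem legendreInv_ne_zero (hF : IsMinkowskiNorm F) {p : Amb n} (hp : p ≠ 0) :
    legendreInv F p ≠ 0 :=
  Function.invFunOn_mem (hF.legendre_surjOn hp)

theorem legendre_legendreInv (hF : IsMinkowskiNorm F) {p : Amb n} (hp : p ≠ 0) :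
    legendre F (legendreInv F p) = p :=
  Function.invFunOn_eq (hF.legendre_surjOn hp)

theorem legendreInv_eq (hF : IsMinkowskiNorm F) {x : Amb n} (hx : x ≠ 0) {p : Amb n}
    (h : legendre F x = p) : legendreInv F p = x := by
  have hp : p ≠ 0 := h ▸ hF.legendre_ne_zero hx
  exact hF.legendre_injOn (hF.legendreInv_ne_zero hp) hx
    ((hF.legendre_legendreInv hp).trans h.symm)

theorem legendreInv_smul (hF : IsMinkowskiNorm F) {t : ℝ} (ht : 0 < t) {p : Amb n} (hp : p ≠ 0) :
    legendreInv F (t • p) = t • legendreInv F p :=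
  hF.legendreInv_eq (smul_ne_zero ht.ne' (hF.legendreInv_ne_zero hp))
    (by rw [hF.legendre_smul ht (hF.legendreInv_ne_zero hp), hF.legendre_legendreInv hp])

/-- Ellipticity makes the derivative invertible; global injectivity identifies the local inverse
with `legendreInv` near `p`. -/
theorem contDiffAt_legendreInv (hF : IsMinkowskiNorm F) {p : Amb n} (hp : p ≠ 0) :
    ContDiffAt ℝ ∞ (legendreInv F) p := by
  set x := legendreInv F p with hx
  have hx0 : x ≠ 0 := hF.legendreInv_ne_zero hp
  have hxp : legendre F x = p := hF.legendre_legendreInv hp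
  have hinj : Function.Injective (fderiv ℝ (legendre F) x : Amb n →ₗ[ℝ] Amb n) := by
    rw [← LinearMap.ker_eq_bot, LinearMap.ker_eq_bot']
    intro ξ hξ
    by_contra h0
    have h1 := hF.elliptic x hx0 ξ h0
    rw [← hF.inner_fderiv_legendre hx0] at h1
    have h2 : fderiv ℝ (legendre F) x ξ = 0 := hξ
    rw [h2, inner_zero_left] at h1
    exact lt_irrefl _ h1
  set L : Amb n ≃L[ℝ] Amb n :=
    (LinearEquiv.ofInjectiveEndo _ hinj).toContinuousLinearEquiv with hL
  have hc := hF.contDiffAt_legendre hx0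
  have hd : HasFDerivAt (legendre F) (L : Amb n →L[ℝ] Amb n) x := by
    have h1 : (L : Amb n →L[ℝ] Amb n) = fderiv ℝ (legendre F) x := by ext ξ; rfl
    rw [h1]
    exact (hc.differentiableAt (by simp)).hasFDerivAt
  have hne : (∞ : WithTop ℕ∞) ≠ 0 := by simp
  have hinv := hc.to_localInverse hd hne
  have hs := hc.hasStrictFDerivAt' hd hne
  rw [← hxp]
  refine hinv.congr_of_eventuallyEq ?_
  have hnz : ∀ᶠ q in 𝓝 (legendre F x), hc.localInverse hd hne q ≠ 0 := by
    refine hinv.continuousAt.eventually_ne ?_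
    rw [hc.localInverse_apply_image hd hne]
    exact hx0
  filter_upwards [hs.eventually_right_inverse, hnz] with q hq hq0
  exact hF.legendreInv_eq hq0 hq

theorem smul_mem_wulff (hF : IsMinkowskiNorm F) {x : Amb n} (hx : x ≠ 0) :
    (F x)⁻¹ • x ∈ wulff F := by
  change F _ = 1
  rw [hF.homogeneous _ (inv_pos.2 (hF.pos x hx)), inv_mul_cancel₀ (hF.pos x hx).ne']

theorem ne_zero_of_mem_wulff (hF : IsMinkowskiNorm F) {x : Amb n} (hx : x ∈ wulff F) : x ≠ 0 := by
  rintro rfl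
  have h1 : F 0 = 1 := hx
  have h2 := hF.homogeneous 2 two_pos 0
  rw [smul_zero, h1] at h2
  norm_num at h2

end IsMinkowskiNorm

/-- The function on the dual space which is positively `1`-homogeneous and corresponds under the
Legendre transformation to the function `S` on the Wulff shape. If `S` is a support function
parametrized by the Wulff shape, then this is the support function in the usual sense. -/
def dualExt {n : ℕ} (F S : Amb n → ℝ) (p : Amb n) : ℝ :=
  F (legendreInv F p) * S ((F (legendreInv F p))⁻¹ • legendreInv F p)

theorem IsMinkowskiNorm.dualExt_legendre {n : ℕ} {F : Amb n → ℝ} (hF : IsMinkowskiNorm F)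
    (S : Amb n → ℝ) {x : Amb n} (hx : x ∈ wulff F) : dualExt F S (legendre F x) = S x := by
  have h1 : F x = 1 := hx
  rw [dualExt, hF.legendreInv_eq (hF.ne_zero_of_mem_wulff hx) rfl, h1]
  simp

theorem IsMinkowskiNorm.isConic_dualExt {n : ℕ} {F : Amb n → ℝ} (hF : IsMinkowskiNorm F)
    {S : Amb n → ℝ} (hS : ContDiffOn ℝ 2 S (wulff F)) : IsConic (dualExt F S) where
  smooth := by
    have h1 : ContDiffOn ℝ 2 (legendreInv F) {0}ᶜ := fun p hp =>
      ((hF.contDiffAt_legendreInv hp).of_le two_le_infty).contDiffWithinAt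
    have h2 : ContDiffOn ℝ 2 (fun p => F (legendreInv F p)) {0}ᶜ :=
      (hF.smooth.of_le two_le_infty).comp h1 fun p hp => hF.legendreInv_ne_zero hp
    refine h2.mul (hS.comp ((h2.inv fun p hp => ?_).smul h1) fun p hp => ?_)
    · exact (hF.pos _ (hF.legendreInv_ne_zero hp)).ne'
    · exact hF.smul_mem_wulff (hF.legendreInv_ne_zero hp)
  homogeneous t ht p hp := by
    have h1 : F (t • legendreInv F p) = t * F (legendreInv F p) := hF.homogeneous t ht _
    rw [dualExt, hF.legendreInv_smul ht hp, h1, smul_smul, mul_inv, mul_assoc, mul_right_comm,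
      inv_mul_cancel₀ ht.ne', one_mul, dualExt]

end AnisoMinkowski

end

/-! ### The tensor `u_ij` as a Euclidean Hessian -/

section

namespace AnisoMinkowski

open Filter Topology

section Calculus

variable {n : ℕ} {V : Type*} [NormedAddCommGroup V] [NormedSpace ℝ V]

theorem HasFDerivAt.pd_eq {f : Par n → V} {f' : Par n →L[ℝ] V} {y : Par n} (h : HasFDerivAt f f' y)
    (i : Fin n) : pd i f y = f' (EuclideanSpace.single i 1) := by
  rw [pd, h.fderiv]

theorem pd_congr {f g : Par n → V} {y : Par n} (h : f =ᶠ[𝓝 y] g) (i : Fin n) :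
    pd i f y = pd i g y := by
  rw [pd, h.fderiv_eq, pd]

theorem fderiv_eq_sum_pd (f : Par n → V) (y ξ : Par n) :
    fderiv ℝ f y ξ = ∑ k, ξ k • pd k f y := by
  have h1 : ξ = ∑ k, ξ k • (EuclideanSpace.single k (1 : ℝ) : Par n) := by
    have := (EuclideanSpace.basisFun (Fin n) ℝ).sum_repr ξ
    simpa using this.symm
  conv_lhs => rw [h1, map_sum]
  simp only [map_smul, pd]

theorem contDiffAt_pd {f : Par n → V} {y : Par n} (hf : ContDiffAt ℝ ∞ f y) (i : Fin n) :
    ContDiffAt ℝ ∞ (pd i f) y :=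
  (hf.fderiv_right (m := ∞) (by simp)).clm_apply contDiffAt_const

theorem pd_pd_eq {f : Par n → V} {y : Par n} (hf : ContDiffAt ℝ ∞ f y) (i j : Fin n) :
    pd i (pd j f) y = fderiv ℝ (fderiv ℝ f) y (EuclideanSpace.single i 1)
      (EuclideanSpace.single j 1) := by
  have h1 : HasFDerivAt (pd j f) _ y :=
    ((hf.fderiv_right (m := ∞) (by simp)).differentiableAt (by simp)).hasFDerivAt.clm_apply
      (hasFDerivAt_const (EuclideanSpace.single j (1 : ℝ)) y)
  rw [HasFDerivAt.pd_eq h1]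
  simp

theorem pd_comm {f : Par n → V} {y : Par n} (hf : ContDiffAt ℝ ∞ f y) (i j : Fin n) :
    pd i (pd j f) y = pd j (pd i f) y := by
  rw [pd_pd_eq hf, pd_pd_eq hf]
  exact (hf.isSymmSndFDerivAt (by simpa using two_le_infty)) _ _

end Calculus

namespace IsMinkowskiNorm

variable {n : ℕ} {F : Amb n → ℝ}

theorem Q_symm_left (hF : IsMinkowskiNorm F) {x : Amb n} (hx : x ≠ 0) (ξ η ζ : Amb n) :
    Q F x ξ η ζ = Q F x η ξ ζ :=
  congrArg (fun L => L ζ)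
    (((hF.contDiffAt_fderiv_halfSq hx).isSymmSndFDerivAt (by simpa using two_le_infty)) ξ η)

theorem hasFDerivAt_hess (hF : IsMinkowskiNorm F) {x : Amb n} (hx : x ≠ 0) :
    HasFDerivAt (hess (halfSq F)) (fderiv ℝ (hess (halfSq F)) x) x :=
  ((hF.contDiffAt_hess_halfSq hx).differentiableAt (by simp)).hasFDerivAt

theorem Q_symm_right (hF : IsMinkowskiNorm F) {x : Amb n} (hx : x ≠ 0) (ξ η ζ : Amb n) :
    Q F x ξ η ζ = Q F x ξ ζ η := by
  have h1 (η ζ : Amb n) := ((hF.hasFDerivAt_hess hx).clm_apply (hasFDerivAt_const η x)).clm_apply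
    (hasFDerivAt_const ζ x)
  have h2 := (h1 η ζ).unique ((h1 ζ η).congr_of_eventuallyEq (by
    filter_upwards [eventually_ne_zero hx] with z hz using hF.G_symm hz η ζ))
  have h3 := congrArg (fun L => L ξ) h2
  simpa [Q] using h3

/-- Differentiate Euler's relation `G(z)(η, z) = D(½F²)(z) η` in the direction `ξ`. -/
theorem Q_self_right (hF : IsMinkowskiNorm F) {x : Amb n} (hx : x ≠ 0) (ξ η : Amb n) :
    Q F x ξ η x = 0 := by
  have h1 := ((hF.hasFDerivAt_hess hx).clm_apply (hasFDerivAt_const η x)).clm_apply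
    (hasFDerivAt_id x)
  have h2 := ((hF.contDiffAt_fderiv_halfSq hx).differentiableAt (by simp)).hasFDerivAt.clm_apply
    (hasFDerivAt_const η x)
  have h3 := h1.unique (h2.congr_of_eventuallyEq (by
    filter_upwards [eventually_ne_zero hx] with z hz using hF.G_self_right hz η))
  have h4 := congrArg (fun L => L ξ) h3
  simp only [add_apply, ContinuousLinearMap.comp_apply, ContinuousLinearMap.flip_apply,
    zero_apply, map_zero, zero_add, ContinuousLinearMap.id_apply, id_eq] at h4
  have h5 : G F x η ξ + Q F x ξ η x = G F x ξ η := h4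
  rw [hF.G_symm hx] at h5
  linarith

end IsMinkowskiNorm

namespace IsLocalParam

variable {n : ℕ} {F : Amb n → ℝ} {U : Set (Par n)} {X : Par n → Amb n} {y : Par n}

theorem contDiffAt (hX : IsLocalParam F U X) (hy : y ∈ U) : ContDiffAt ℝ ∞ X y :=
  hX.smooth.contDiffAt (hX.isOpen.mem_nhds hy)

theorem hasFDerivAt (hX : IsLocalParam F U X) (hy : y ∈ U) : HasFDerivAt X (fderiv ℝ X y) y :=
  ((hX.contDiffAt hy).differentiableAt (by simp)).hasFDerivAt

theorem ne_zero (hX : IsLocalParam F U X) (hF : IsMinkowskiNorm F) (hy : y ∈ U) : X y ≠ 0 :=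
  hF.ne_zero_of_mem_wulff (hX.mapsTo hy)

theorem fderiv_halfSq_fderiv (hX : IsLocalParam F U X) (hF : IsMinkowskiNorm F) (hy : y ∈ U)
    (ξ : Par n) : fderiv ℝ (halfSq F) (X y) (fderiv ℝ X y ξ) = 0 := by
  have h1 := (((hF.contDiffAt_halfSq (hX.ne_zero hF hy)).differentiableAt
    (by simp)).hasFDerivAt.comp y (hX.hasFDerivAt hy))
  have h2 : HasFDerivAt (halfSq F ∘ X) (0 : Par n →L[ℝ] ℝ) y := by
    refine (hasFDerivAt_const (1 / 2 : ℝ) y).congr_of_eventuallyEq ?_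
    filter_upwards [hX.isOpen.mem_nhds hy] with z hz
    have : F (X z) = 1 := hX.mapsTo hz
    simp [halfSq, this]
  exact congrArg (fun L => L ξ) (h1.unique h2)

/-- The Gauss map in local coordinates. -/
theorem contDiffAt_legendre (hX : IsLocalParam F U X) (hF : IsMinkowskiNorm F) (hy : y ∈ U) :
    ContDiffAt ℝ ∞ (fun z => legendre F (X z)) y :=
  (hF.contDiffAt_legendre (hX.ne_zero hF hy)).comp y (hX.contDiffAt hy)

theorem inner_pd_legendre (hX : IsLocalParam F U X) (hF : IsMinkowskiNorm F) (hy : y ∈ U)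
    (i : Fin n) (a : Amb n) :
    inner ℝ (pd i (fun z => legendre F (X z)) y) a = G F (X y) (pd i X y) a := by
  have hx := hX.ne_zero hF hy
  have h1 := ((hF.contDiffAt_legendre hx).differentiableAt (by simp)).hasFDerivAt.comp y
    (hX.hasFDerivAt hy)
  rw [HasFDerivAt.pd_eq (f := fun z => legendre F (X z)) h1, ContinuousLinearMap.comp_apply,
    hF.inner_fderiv_legendre hx]
  rfl

theorem pd_G (hX : IsLocalParam F U X) (hF : IsMinkowskiNorm F) (hy : y ∈ U) {Y Z : Par n → Amb n}
    (hY : DifferentiableAt ℝ Y y) (hZ : DifferentiableAt ℝ Z y) (i : Fin n) :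
    pd i (fun z => G F (X z) (Y z) (Z z)) y =
      Q F (X y) (pd i X y) (Y y) (Z y) + G F (X y) (pd i Y y) (Z y) +
        G F (X y) (Y y) (pd i Z y) := by
  have h0 : HasFDerivAt (fun z => hess (halfSq F) (X z))
      ((fderiv ℝ (hess (halfSq F)) (X y)).comp (fderiv ℝ X y)) y :=
    HasFDerivAt.comp (g := hess (halfSq F)) (F := Amb n) (G := Amb n →L[ℝ] Amb n →L[ℝ] ℝ) y
      (hF.hasFDerivAt_hess (hX.ne_zero hF hy)) (hX.hasFDerivAt hy)
  have h1 := h0.clm_apply hY.hasFDerivAt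
  have h2 := h1.clm_apply hZ.hasFDerivAt
  have h3 : pd i (fun z => G F (X z) (Y z) (Z z)) y = _ := HasFDerivAt.pd_eq h2 i
  rw [h3]
  simp only [add_apply, ContinuousLinearMap.comp_apply, ContinuousLinearMap.flip_apply,
    G, Q, pd]
  ring

/-- Differentiate the tangency relation `D(½F²)(X)(∂_j X) = 0`; this is the normal part of a Gauss
formula. -/
theorem G_self_pd_pd (hX : IsLocalParam F U X) (hF : IsMinkowskiNorm F) (hy : y ∈ U)
    (i j : Fin n) : G F (X y) (pd i (pd j X) y) (X y) = -metric F X y i j := by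
  have hx := hX.ne_zero hF hy
  have h1 := (((hF.contDiffAt_fderiv_halfSq hx).differentiableAt (by simp)).hasFDerivAt.comp y
    (hX.hasFDerivAt hy)).clm_apply
      ((contDiffAt_pd (hX.contDiffAt hy) j).differentiableAt (by simp)).hasFDerivAt
  have h2 := h1.unique ((hasFDerivAt_const (0 : ℝ) y).congr_of_eventuallyEq (by
    filter_upwards [hX.isOpen.mem_nhds hy] with z hz using hX.fderiv_halfSq_fderiv hF hz _))
  have h3 := congrArg (fun L => L (EuclideanSpace.single i 1)) h2
  simp only [add_apply, ContinuousLinearMap.comp_apply, ContinuousLinearMap.flip_apply,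
    zero_apply] at h3
  have h4 : fderiv ℝ (halfSq F) (X y) (pd i (pd j X) y) + metric F X y i j = 0 := h3
  rw [hF.G_self_right hx]
  linarith

theorem pd_metric (hX : IsLocalParam F U X) (hF : IsMinkowskiNorm F) (hy : y ∈ U)
    (i j l : Fin n) : pd i (fun z => metric F X z j l) y =
      Q F (X y) (pd i X y) (pd j X y) (pd l X y) + G F (X y) (pd i (pd j X) y) (pd l X y) +
        G F (X y) (pd j X y) (pd i (pd l X) y) :=
  hX.pd_G hF hy ((contDiffAt_pd (hX.contDiffAt hy) j).differentiableAt (by simp))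
    ((contDiffAt_pd (hX.contDiffAt hy) l).differentiableAt (by simp)) i

/-- Each derivative of the metric contributes one `Q` term. By total symmetry of `Q` two of the
three cancel, leaving `½ Q`. -/
theorem christoffel_eq (hX : IsLocalParam F U X) (hF : IsMinkowskiNorm F) (hy : y ∈ U)
    (k i j : Fin n) : christoffel F X k i j y = ∑ l, (metric F X y)⁻¹ k l *
      ((1 / 2) * Q F (X y) (pd i X y) (pd j X y) (pd l X y) +
        G F (X y) (pd i (pd j X) y) (pd l X y)) := by
  have hx := hX.ne_zero hF hy
  rw [christoffel, Finset.mul_sum]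
  refine Finset.sum_congr rfl fun l _ => ?_
  rw [hX.pd_metric hF hy, hX.pd_metric hF hy, hX.pd_metric hF hy, pd_comm (hX.contDiffAt hy) j i,
    pd_comm (hX.contDiffAt hy) l i, pd_comm (hX.contDiffAt hy) l j,
    hF.Q_symm_left hx (pd j X y), hF.Q_symm_left hx (pd l X y) (pd i X y),
    hF.Q_symm_right hx (pd i X y) (pd l X y), hF.G_symm hx (pd j X y)]
  ring

theorem metric_posDef (hX : IsLocalParam F U X) (hF : IsMinkowskiNorm F) (hy : y ∈ U) :
    (metric F X y).PosDef := by
  have hx := hX.ne_zero hF hy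
  refine Matrix.PosDef.of_dotProduct_mulVec_pos ?_ fun c hc => ?_
  · ext i j
    simp [metric, hF.G_symm hx (pd j X y)]
  · have h1 := dotProduct_gramMat_mulVec (hess (halfSq F) (X y)) (fun i => pd i X y) c
    rw [star_trivial]
    refine lt_of_lt_of_eq (hF.elliptic _ hx (∑ i, c i • pd i X y) ?_) h1.symm
    have h2 := fderiv_eq_sum_pd X y (WithLp.toLp 2 c)
    intro h3
    refine hc ?_
    have h4 : WithLp.toLp 2 c = (0 : Par n) := hX.immersion y hy (by rw [map_zero, h2]; exact h3)
    ext i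
    simpa using congrArg (fun v : Par n => v i) h4

theorem eq_zero_of_G_eq_zero (hX : IsLocalParam F U X) (hF : IsMinkowskiNorm F) (hy : y ∈ U)
    {r : Amb n} (h0 : G F (X y) r (X y) = 0) (h1 : ∀ k, G F (X y) r (pd k X y) = 0) : r = 0 := by
  have hx := hX.ne_zero hF hy
  have hFX : F (X y) = 1 := hX.mapsTo hy
  let T : Par n × ℝ →ₗ[ℝ] Amb n :=
    (fderiv ℝ X y : Par n →ₗ[ℝ] Amb n).coprod (LinearMap.toSpanSingleton ℝ _ (X y))
  have hT (ξ : Par n) (s : ℝ) : T (ξ, s) = fderiv ℝ X y ξ + s • X y := by simp [T]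
  have hinj : Function.Injective T := by
    rw [← LinearMap.ker_eq_bot, LinearMap.ker_eq_bot']
    rintro ⟨ξ, s⟩ h
    rw [hT] at h
    have h2 := congrArg (fderiv ℝ (halfSq F) (X y)) h
    rw [map_add, hX.fderiv_halfSq_fderiv hF hy, map_smul, hF.fderiv_halfSq_self hx, hFX] at h2
    have hs : s = 0 := by simpa using h2
    rw [hs, zero_smul, add_zero] at h
    rw [hs, hX.immersion y hy (h.trans (map_zero _).symm)]
    rfl
  have hsurj : Function.Surjective T :=
    (LinearMap.injective_iff_surjective_of_finrank_eq_finrank (by simp)).1 hinj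
  obtain ⟨⟨ξ, s⟩, hr⟩ := hsurj r
  rw [hT, fderiv_eq_sum_pd] at hr
  by_contra hr0
  have h2 := hF.elliptic _ hx r hr0
  refine h2.ne' ?_
  have h3 : G F (X y) r (∑ k, ξ k • pd k X y + s • X y) = 0 := by
    simp only [G, map_add, map_sum, map_smul] at h0 h1 ⊢
    simp [h0, h1]
  rwa [hr] at h3

/-- In terms of the `1`-homogeneous extension to the dual space, the tensor
`w_ij - ½ Q_ijk w_k + w g_ij` is the Euclidean Hessian. -/
theorem uTensor_eq (hX : IsLocalParam F U X) (hF : IsMinkowskiNorm F) (hy : y ∈ U) {S : Amb n → ℝ}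
    (hS : ContDiffOn ℝ 2 S (wulff F)) (i j : Fin n) :
    uTensor F X S y i j = hess (dualExt F S) (legendre F (X y))
      (pd i (fun z => legendre F (X z)) y) (pd j (fun z => legendre F (X z)) y) := by
  have hx := hX.ne_zero hF hy
  have hFX : F (X y) = 1 := hX.mapsTo hy
  have hh := hF.isConic_dualExt hS
  set h := dualExt F S with hh_def
  set p : Par n → Amb n := fun z => legendre F (X z) with hp_def
  have hp0 {z : Par n} (hz : z ∈ U) : p z ≠ 0 := hF.legendre_ne_zero (hX.ne_zero hF hz)
  have hpc {z : Par n} (hz : z ∈ U) : ContDiffAt ℝ ∞ p z := hX.contDiffAt_legendre hF hz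
  have hpd {z : Par n} (hz : z ∈ U) : HasFDerivAt p (fderiv ℝ p z) z :=
    ((hpc hz).differentiableAt (by simp)).hasFDerivAt
  have hSX {z : Par n} (hz : z ∈ U) : h (p z) = S (X z) :=
    hF.dualExt_legendre S (hX.mapsTo hz)
  set w : Fin n → ℝ := fun k => pd k (S ∘ X) y with hw
  have hw1 {z : Par n} (hz : z ∈ U) (k : Fin n) :
      pd k (S ∘ X) z = fderiv ℝ h (p z) (pd k p z) := by
    have h1 : S ∘ X =ᶠ[𝓝 z] h ∘ p := by
      filter_upwards [hX.isOpen.mem_nhds hz] with u hu using (hSX hu).symm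
    rw [pd_congr h1, HasFDerivAt.pd_eq ((hh.differentiableAt (hp0 hz)).hasFDerivAt.comp z (hpd hz))]
    rfl
  -- For a support function `h` this gradient is the point of the hypersurface; below it is expanded
  -- as `S X + ∇S` in the frame `X`, `∂_k X`.
  set a := grad h (p y) with ha
  have ha1 (v : Amb n) : inner ℝ v a = fderiv ℝ h (p y) v := by
    rw [real_inner_comm]; exact InnerProductSpace.toDual_symm_apply
  have hGa (k : Fin n) : G F (X y) (pd k X y) a = w k := by
    rw [← hX.inner_pd_legendre hF hy, ha1, hw]
    exact (hw1 hy k).symm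
  have hGXa : G F (X y) (X y) a = S (X y) := by
    rw [hF.G_self_left hx, ← inner_legendre, ha1]
    exact (hh.fderiv_self (hp0 hy)).trans (hSX hy)
  -- Differentiating `h ∘ p` twice leaves `⟨∂_i ∂_j p, a⟩` beside the Hessian. It is computed by
  -- differentiating `⟨∂_j p, a⟩ = G(X)(∂_j X, a)` with `a` frozen at `y`.
  have hsecond : pd i (pd j (S ∘ X)) y = hess h (p y) (pd i p y) (pd j p y) +
      (Q F (X y) (pd i X y) (pd j X y) a + G F (X y) (pd i (pd j X) y) a) := by
    have h1 : pd j (S ∘ X) =ᶠ[𝓝 y] fun z => fderiv ℝ h (p z) (pd j p z) := by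
      filter_upwards [hX.isOpen.mem_nhds hy] with z hz using hw1 hz j
    have hpj : DifferentiableAt ℝ (pd j p) y := (contDiffAt_pd (hpc hy) j).differentiableAt (by simp)
    have h2 := ((hh.differentiableAt_fderiv (hp0 hy)).hasFDerivAt.comp y (hpd hy)).clm_apply
      hpj.hasFDerivAt
    have h3 : pd i (fun z => inner ℝ (pd j p z) a) y = inner ℝ (pd i (pd j p) y) a := by
      rw [HasFDerivAt.pd_eq (hpj.hasFDerivAt.inner ℝ (hasFDerivAt_const a y))]
      simp [pd]
    have h4 : (fun z => inner ℝ (pd j p z) a) =ᶠ[𝓝 y] fun z => G F (X z) (pd j X z) a := by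
      filter_upwards [hX.isOpen.mem_nhds hy] with z hz using hX.inner_pd_legendre hF hz j a
    rw [pd_congr h4, hX.pd_G hF hy ((contDiffAt_pd (hX.contDiffAt hy) j).differentiableAt (by simp))
      (differentiableAt_const a)] at h3
    have h5 : pd i (fun _ : Par n => a) y = 0 := by simp [pd]
    have h6 : G F (X y) (pd j X y) 0 = 0 := map_zero _
    rw [h5, h6, add_zero, ha1] at h3
    rw [pd_congr h1, HasFDerivAt.pd_eq (f := fun z => fderiv ℝ h (p z) (pd j p z)) h2, h3, add_comm]
    rfl
  set g := metric F X y with hg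
  have hgpos := hX.metric_posDef hF hy
  have hgg : g * g⁻¹ = 1 := Matrix.mul_nonsing_inv _ (isUnit_iff_ne_zero.2 hgpos.det_pos.ne')
  have hgsymm (k l : Fin n) : g⁻¹ k l = g⁻¹ l k := by
    simpa using (hgpos.inv.isHermitian.apply k l).symm
  set α : Fin n → ℝ := g⁻¹.mulVec w with hα
  have hgα : g.mulVec α = w := by rw [hα, Matrix.mulVec_mulVec, hgg, Matrix.one_mulVec]
  have hexp : a = S (X y) • X y + ∑ k, α k • pd k X y := by
    rw [← sub_eq_zero]
    have hXpd (k : Fin n) : G F (X y) (X y) (pd k X y) = 0 := by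
      rw [hF.G_self_left hx]; exact hX.fderiv_halfSq_fderiv hF hy _
    refine hX.eq_zero_of_G_eq_zero hF hy ?_ fun k => ?_
    · have h1 (k : Fin n) : G F (X y) (pd k X y) (X y) = 0 := by rw [hF.G_symm hx, hXpd]
      have h2 : G F (X y) a (X y) = S (X y) := by rw [hF.G_symm hx, hGXa]
      have h3 : G F (X y) (X y) (X y) = 1 := by
        rw [hF.G_self_left hx, hF.fderiv_halfSq_self hx, hFX, one_pow]
      simp only [G] at h1 h2 h3 ⊢
      simp [h1, h2, h3]
    · have h1 := congrFun hgα k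
      have h2 : G F (X y) a (pd k X y) = w k := by rw [hF.G_symm hx, hGa]
      have h3 : ∑ l, α l * G F (X y) (pd l X y) (pd k X y) = w k := by
        rw [← h1]
        simp only [Matrix.mulVec, dotProduct, hg, metric, Matrix.of_apply]
        exact Finset.sum_congr rfl fun l _ => by rw [hF.G_symm hx, mul_comm]
      have h4 := hXpd k
      simp only [G] at h2 h3 h4 ⊢
      simp [h2, h3, h4]
  have hQa : Q F (X y) (pd i X y) (pd j X y) a =
      ∑ k, α k * Q F (X y) (pd i X y) (pd j X y) (pd k X y) := by
    have h1 := hF.Q_self_right hx (pd i X y) (pd j X y)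
    rw [hexp]
    simp only [Q] at h1 ⊢
    simp [h1]
  have hGija : G F (X y) (pd i (pd j X) y) a =
      -(S (X y) * g i j) + ∑ k, α k * G F (X y) (pd i (pd j X) y) (pd k X y) := by
    have h1 := hX.G_self_pd_pd hF hy i j
    rw [hexp]
    simp only [G] at h1 ⊢
    simp [h1, hg]
  have hΓ : ∑ k, christoffel F X k i j y * w k =
      ∑ l, α l * ((1 / 2) * Q F (X y) (pd i X y) (pd j X y) (pd l X y) +
        G F (X y) (pd i (pd j X) y) (pd l X y)) := by
    simp only [hX.christoffel_eq hF hy, Finset.sum_mul]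
    rw [Finset.sum_comm]
    refine Finset.sum_congr rfl fun l _ => ?_
    simp only [hα, Matrix.mulVec, dotProduct, Finset.sum_mul]
    refine Finset.sum_congr rfl fun k _ => ?_
    rw [← hg, hgsymm k l]
    ring
  have hfinal : uTensor F X S y i j = pd i (pd j (S ∘ X)) y - ∑ k, christoffel F X k i j y * w k -
      (1 / 2) * ∑ k, Q F (X y) (pd i X y) (pd j X y) (pd k X y) * α k + S (X y) * g i j := rfl
  -- All but the Hessian cancels: the full `Q` from the second derivative against one half from the
  -- Christoffel symbols and one half from the definition, and `-S g` against `+S g`.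
  rw [hfinal, hsecond, hΓ, hQa, hGija]
  simp only [mul_add, Finset.sum_add_distrib, Finset.mul_sum]
  have h1 : ∑ k, α k * ((1 / 2) * Q F (X y) (pd i X y) (pd j X y) (pd k X y)) =
      (1 / 2) * ∑ k, α k * Q F (X y) (pd i X y) (pd j X y) (pd k X y) := by
    rw [Finset.mul_sum]; exact Finset.sum_congr rfl fun k _ => by ring
  have h2 : ∑ k, (1 / 2) * (Q F (X y) (pd i X y) (pd j X y) (pd k X y) * α k) =
      (1 / 2) * ∑ k, α k * Q F (X y) (pd i X y) (pd j X y) (pd k X y) := by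
    rw [Finset.mul_sum]; exact Finset.sum_congr rfl fun k _ => by ring
  rw [h1, h2]
  ring

end IsLocalParam

end AnisoMinkowski

end

/-! ### From the kernel equation to a trace condition on Hessians -/

section

namespace AnisoMinkowski

open Filter Topology

variable {n : ℕ} {F : Amb n → ℝ}

/-- The determinant is affine in each single entry, with the cofactor as slope. -/
theorem dSigma_eq_adjugate (u : Matrix (Fin n) (Fin n) ℝ) (i j : Fin n) :
    dSigma u i j = u.adjugate j i := by
  have h1 (t : ℝ) : (u + Matrix.single i j t).det = u.det + t * u.adjugate j i := by
    have h2 : u + Matrix.single i j t = u.updateRow i (u i + t • Pi.single j 1) := by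
      ext k l
      rcases eq_or_ne k i with rfl | hk
      · rcases eq_or_ne l j with rfl | hl
        · simp
        · simp [hl, Matrix.single_apply_of_col_ne _ _ (Ne.symm hl)]
      · simp [hk, Matrix.single_apply_of_row_ne (Ne.symm hk)]
    rw [h2, Matrix.det_updateRow_add, Matrix.updateRow_eq_self, Matrix.det_updateRow_smul,
      Matrix.adjugate_apply]
  have h3 : HasDerivAt (fun t : ℝ => (u + Matrix.single i j t).det) (u.adjugate j i) 0 := by
    simp only [h1]
    simpa using ((hasDerivAt_id (0 : ℝ)).mul_const (u.adjugate j i)).const_add u.det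
  exact h3.deriv

theorem linOp_eq_trace (X : Par n → Amb n) (S v : Amb n → ℝ) (y : Par n) :
    linOp F X S v y = ((uMixed F X S y).adjugate * uMixed F X v y).trace := by
  simp only [linOp, dSigma_eq_adjugate, Matrix.trace, Matrix.diag, Matrix.mul_apply]
  exact Finset.sum_comm

/-- The metric cancels in `uMixed(S)⁻¹ * uMixed(v)`, and the inverse is a multiple of the adjugate.
-/
theorem IsLocalParam.trace_inv_mul_eq_zero {U : Set (Par n)} {X : Par n → Amb n} {y : Par n}
    (hX : IsLocalParam F U X) (hF : IsMinkowskiNorm F) (hy : y ∈ U) {S v : Amb n → ℝ}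
    (h : linOp F X S v y = 0) : ((uTensor F X S y)⁻¹ * uTensor F X v y).trace = 0 := by
  have hg := isUnit_iff_ne_zero.2 (hX.metric_posDef hF hy).det_pos.ne'
  have h1 : (uTensor F X S y)⁻¹ * uTensor F X v y =
      (uMixed F X S y)⁻¹ * uMixed F X v y := by
    rw [uMixed, uMixed, Matrix.mul_inv_rev, Matrix.nonsing_inv_nonsing_inv _ hg, Matrix.mul_assoc,
      ← Matrix.mul_assoc (metric F X y), Matrix.mul_nonsing_inv _ hg, Matrix.one_mul]
  rw [h1, Matrix.inv_def, Matrix.smul_mul, Matrix.trace_smul, ← linOp_eq_trace, h, smul_zero]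

/-- Around every point of the Wulff shape there is a local parametrization whose Gauss map is the
central projection of an affine hyperplane. -/
theorem IsMinkowskiNorm.exists_isLocalParam (hF : IsMinkowskiNorm F) {p : Amb n} (hp : p ≠ 0) :
    ∃ (X : Par n → Amb n) (e : Fin n → Amb n) (κ : ℝ), IsLocalParam F Set.univ X ∧
      Orthonormal ℝ e ∧ (∀ i, inner ℝ p (e i) = 0) ∧ 0 < κ ∧ legendre F (X 0) = κ • p ∧
      ∀ i, ∃ s : ℝ, pd i (fun z => legendre F (X z)) 0 = κ • e i + s • p := by
  have : Fact (Module.finrank ℝ (Amb n) = n + 1) := ⟨by simp⟩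
  let b : OrthonormalBasis (Fin n) ℝ (ℝ ∙ p)ᗮ := OrthonormalBasis.fromOrthogonalSpanSingleton n hp
  let E : Par n →L[ℝ] Amb n := (ℝ ∙ p)ᗮ.subtypeL.comp
    (b.repr.symm.toContinuousLinearEquiv : Par n →L[ℝ] (ℝ ∙ p)ᗮ)
  have hE (y : Par n) : inner ℝ p (E y) = 0 :=
    Submodule.mem_orthogonal_singleton_iff_inner_right.1 (b.repr.symm y).2
  have hEinj : Function.Injective E := Subtype.val_injective.comp b.repr.symm.injective
  have hEe (i : Fin n) : E (EuclideanSpace.single i 1) = b i := by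
    change ((b.repr.symm (EuclideanSpace.single i 1) : (ℝ ∙ p)ᗮ) : Amb n) = b i
    rw [b.repr_symm_single]
  have hpp : (0 : ℝ) < inner ℝ p p := real_inner_self_pos.2 hp
  -- Points of the affine hyperplane through `p` orthogonal to `p`, pulled back by the Legendre map
  -- and rescaled by `1 / k` onto the Wulff shape. Pairing with `p`, constant on this hyperplane,
  -- eliminates `k` in the injectivity and immersion arguments.
  set c : Par n → Amb n := fun y => p + E y with hc
  have hpc (y : Par n) : inner ℝ p (c y) = inner ℝ p p := by
    simp only [hc, inner_add_right, hE, add_zero]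
  have hc0 (y : Par n) : c y ≠ 0 := by
    intro h
    have := hpc y
    rw [h, inner_zero_right] at this
    exact hpp.ne this
  have hcd (y : Par n) : HasFDerivAt c E y := E.hasFDerivAt.const_add p
  have hcs : ContDiff ℝ ∞ c := contDiff_const.add E.contDiff
  set k : Par n → ℝ := fun y => F (legendreInv F (c y)) with hk
  have hk0 (y : Par n) : 0 < k y := hF.pos _ (hF.legendreInv_ne_zero (hc0 y))
  have hms (y : Par n) : ContDiffAt ℝ ∞ (fun y => legendreInv F (c y)) y :=
    (hF.contDiffAt_legendreInv (hc0 y)).comp y hcs.contDiffAt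
  have hks (y : Par n) : ContDiffAt ℝ ∞ k y :=
    (hF.contDiffAt (hF.legendreInv_ne_zero (hc0 y))).comp y (hms y)
  set X : Par n → Amb n := fun y => (k y)⁻¹ • legendreInv F (c y) with hX
  have hXs (y : Par n) : ContDiffAt ℝ ∞ X y := ((hks y).inv (hk0 y).ne').smul (hms y)
  have hX0 (y : Par n) : X y ≠ 0 :=
    smul_ne_zero (inv_pos.2 (hk0 y)).ne' (hF.legendreInv_ne_zero (hc0 y))
  have hlX (y : Par n) : legendre F (X y) = (k y)⁻¹ • c y := by
    rw [hX, hF.legendre_smul (inv_pos.2 (hk0 y)) (hF.legendreInv_ne_zero (hc0 y)),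
      hF.legendre_legendreInv (hc0 y)]
  have hkd (y : Par n) : HasFDerivAt k (fderiv ℝ k y) y :=
    ((hks y).differentiableAt (by simp)).hasFDerivAt
  refine ⟨X, fun i => b i, (k 0)⁻¹, ⟨isOpen_univ, fun y _ => (hXs y).contDiffWithinAt,
    fun y _ => hF.smul_mem_wulff (hF.legendreInv_ne_zero (hc0 y)), fun y _ z _ hyz => ?_,
    fun y _ => ?_⟩, ?_, fun i => ?_, inv_pos.2 (hk0 0), ?_, fun i => ?_⟩
  · have h1 : (k y)⁻¹ • c y = (k z)⁻¹ • c z := by rw [← hlX, ← hlX, hyz]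
    have h2 := congrArg (fun w => inner ℝ p w) h1
    simp only [inner_smul_right, hpc] at h2
    have h3 : (k y)⁻¹ = (k z)⁻¹ := mul_right_cancel₀ hpp.ne' h2
    rw [h3] at h1
    have h4 := smul_right_injective _ (inv_pos.2 (hk0 z)).ne' h1
    exact hEinj (add_left_cancel h4)
  · rw [injective_iff_map_eq_zero]
    intro ξ hξ
    have h1 : HasFDerivAt (fun z => legendre F (X z)) _ y :=
      ((hF.contDiffAt_legendre (hX0 y)).differentiableAt (by simp)).hasFDerivAt.comp y
        ((hXs y).differentiableAt (by simp)).hasFDerivAt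
    have h2 := (hkd y).smul h1
    have h3 : (k • fun z => legendre F (X z)) = c := by
      ext1 z
      simp only [Pi.smul_apply', hlX, smul_smul, mul_inv_cancel₀ (hk0 z).ne', one_smul]
    rw [h3] at h2
    have h4 := congrArg (fun L => L ξ) (h2.unique (hcd y))
    simp only [add_apply, smul_apply, ContinuousLinearMap.comp_apply, hξ, map_zero, smul_zero,
      zero_add, ContinuousLinearMap.smulRight_apply, hlX] at h4
    have h5 := congrArg (fun w => inner ℝ p w) h4
    simp only [inner_smul_right, hpc, hE] at h5
    have h6 : fderiv ℝ k y ξ = 0 :=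
      (mul_eq_zero.1 h5).resolve_right (mul_pos (inv_pos.2 (hk0 y)) hpp).ne'
    rw [h6, zero_smul] at h4
    exact hEinj (h4.symm.trans (map_zero E).symm)
  · exact b.orthonormal.comp_linearIsometry (ℝ ∙ p)ᗮ.subtypeₗᵢ
  · change inner ℝ p (b i : Amb n) = 0
    rw [← hEe]
    exact hE _
  · rw [hlX]; simp [hc]
  · have h1 : (fun z => legendre F (X z)) = (fun z => (k z)⁻¹ • c z) := funext hlX
    have hki : HasFDerivAt (fun z => (k z)⁻¹) (fderiv ℝ (fun z => (k z)⁻¹) 0) 0 :=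
      (((hks 0).inv (hk0 0).ne').differentiableAt (by simp)).hasFDerivAt
    have h2 : HasFDerivAt (fun z => (k z)⁻¹ • c z) _ 0 := hki.smul (hcd 0)
    refine ⟨fderiv ℝ (fun z => (k z)⁻¹) 0 (EuclideanSpace.single i 1), ?_⟩
    rw [h1, HasFDerivAt.pd_eq h2]
    simp [hEe, hc]

theorem IsMinkowskiNorm.gramMat_hyp (hF : IsMinkowskiNorm F) {S v : Amb n → ℝ}
    (hS : IsAdmissible F S) (hv : ContDiffOn ℝ 2 v (wulff F)) (hker : InKernel F S v) {p : Amb n}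
    (hp : p ≠ 0) : ∃ e : Fin n → Amb n, Orthonormal ℝ e ∧ (∀ i, inner ℝ p (e i) = 0) ∧
      (gramMat (hess (dualExt F S) p) e).PosDef ∧
      ((gramMat (hess (dualExt F S) p) e)⁻¹ * gramMat (hess (dualExt F v) p) e).trace = 0 := by
  obtain ⟨X, e, κ, hX, he, hpe, hκ, hX0, hder⟩ := hF.exists_isLocalParam hp
  -- The radial parts of `∂_i p` lie in the kernel of the Hessian. Two factors `κ` from the
  -- tangential parts and `κ⁻¹` from the Hessian at `κ • p` leave `κ` in all.
  have key {w : Amb n → ℝ} (hw : ContDiffOn ℝ 2 w (wulff F)) :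
      gramMat (hess (dualExt F w) p) e = κ⁻¹ • uTensor F X w 0 := by
    have hh := hF.isConic_dualExt hw
    ext i j
    obtain ⟨s, hs⟩ := hder i
    obtain ⟨t, ht⟩ := hder j
    rw [Matrix.smul_apply, hX.uTensor_eq hF (Set.mem_univ 0) hw, hX0, hh.hess_smul hκ hp, hs, ht]
    have h1 := hh.hess_self hp
    have h2 := hh.hess_apply_self hp
    simp only [gramMat, Matrix.of_apply, map_add, map_smul, add_apply, smul_apply, smul_eq_mul,
      h1, h2, zero_apply]
    field_simp
    ring
  have hA := hS.posDef _ X hX 0 (Set.mem_univ 0)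
  refine ⟨e, he, hpe, ?_, ?_⟩
  · rw [key hS.contDiffOn]
    exact hA.smul (inv_pos.2 hκ)
  · rw [key hS.contDiffOn, key hv]
    exact trace_inv_smul_mul_smul_eq_zero hA (inv_pos.2 hκ) _
      (hX.trace_inv_mul_eq_zero hF (Set.mem_univ 0) (hker _ X hX 0 (Set.mem_univ 0)))

end AnisoMinkowski

end

end

/-! ### The kernel of the linearized operator -/

theorem lemma5p4 (n : ℕ) (hn : 1 ≤ n)
    (F : AnisoMinkowski.Amb n → ℝ) (hF : AnisoMinkowski.IsMinkowskiNorm F)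
    (S : AnisoMinkowski.Amb n → ℝ) (hS : AnisoMinkowski.IsAdmissible F S)
    (v : AnisoMinkowski.Amb n → ℝ) (hv : ContDiffOn ℝ 2 v (AnisoMinkowski.wulff F))
    (hker : AnisoMinkowski.InKernel F S v) :
    ∃ a : Fin (n + 1) → ℝ, ∀ z ∈ AnisoMinkowski.wulff F,
      v z = ∑ α, a α * AnisoMinkowski.G F z z (EuclideanSpace.single α 1) := by
  obtain ⟨a, ha⟩ := AnisoMinkowski.exists_eq_linear hn (hF.isConic_dualExt hS.contDiffOn)
    (hF.isConic_dualExt hv) fun p hp => hF.gramMat_hyp hS hv hker hp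
  -- The coordinates of the linear functional `a`; those of `legendre F z` are `G(z)(z, E^α)` by
  -- Euler's identity.
  refine ⟨fun α => a (EuclideanSpace.single α 1), fun z hz => ?_⟩
  have hz0 := hF.ne_zero_of_mem_wulff hz
  rw [← hF.dualExt_legendre v hz, ha _ (hF.legendre_ne_zero hz0)]
  have h1 : AnisoMinkowski.legendre F z = ∑ α, AnisoMinkowski.legendre F z α •
      (EuclideanSpace.single α (1 : ℝ) : AnisoMinkowski.Amb n) := by
    have := (EuclideanSpace.basisFun (Fin (n + 1)) ℝ).sum_repr (AnisoMinkowski.legendre F z)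
    simpa using this.symm
  conv_lhs => rw [h1, map_sum]
  refine Finset.sum_congr rfl fun α _ => ?_
  have h2 : AnisoMinkowski.legendre F z α =
      AnisoMinkowski.G F z z (EuclideanSpace.single α 1) := by
    rw [hF.G_self_left hz0, ← AnisoMinkowski.inner_legendre,
      EuclideanSpace.inner_single_right]
    simp
  rw [map_smul, smul_eq_mul, h2, mul_comm]
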